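/- Let $d,m\ge 0$ be integers, let $\mathbb T^d=[0,2\pi]^d$ and $\mathrm d\mu(\vartheta)=(2\pi)^{-d}\prod_{k=1}^d\mathrm d\vartheta_k$. Let $p_{\mathbf x}$ and $p_{\mathbf y}$ be the laws of zero-mean, Gaussian, stationary random fields $\mathbf x=\{\mathbf x_t,\ t\in\mathbb Z^d\}$ and $\mathbf y=\{\mathbf y_t,\ t\in\mathbb Z^d\}$ with values in $\mathbb R^m$ which have power spectral densities $\Phi_{\mathbf x},\Phi_{\mathbf y}:\mathbb T^d\to\mathbb C^{m\times m}$, i.e. $\Phi_{\mathbf x}$ is integrable with $\mathbb E[\mathbf x_{t+s}\mathbf x_s^T]=\int_{\mathbb T^d}\Phi_{\mathbf x}(\vartheta)e^{\mathrm i\langle\vartheta,t\rangle}\,\mathrm d\mu(\vartheta)$ for all $t,s\in\mathbb Z^d$, and likewise for $\Phi_{\mathbf y}$. Assume that $\Phi_{\mathbf x}$ and $\Phi_{\mathbf y}$ are bounded and coercive: for some constants $0<c\le C$ one has $cI\le\Phi_{\mathbf x}\le CI$ and $cI\le\Phi_{\mathbf y}\le CI$ almost everywhere. Define $d(p_{\mathbf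 x},p_{\mathbf y})\ge 0$ by $$d(p_{\mathbf x},p_{\mathbf y})^2=\inf\ \mathbb E\|\mathbf x_t-\mathbf y_t\|^2,$$ where the infimum is over all laws of jointly Gaussian, jointly stationary pairs $(\mathbf x,\mathbf y)$ of random fields such that $\mathbf x$ has law $p_{\mathbf x}$ and $\mathbf y$ has law $p_{\mathbf y}$; by stationarity it does not depend on $t\in\mathbb Z^d$. Then such pairs exist, the matrix function below is integrable, and $$d(p_{\mathbf x},p_{\mathbf y})^2=\operatorname{tr}\int_{\mathbb T^d}\Big(\Phi_{\mathbf x}+\Phi_{\mathbf y}-2\big(\Phi_{\mathbf y}^{1/2}\,\Phi_{\mathbf x}\,\Phi_{\mathbf y}^{1/2}\big)^{1/2}\Big)\,\mathrm d\mu .$$ That is, $d(p_{\mathbf x},p_{\mathbf y})$ is the Hellinger distance between $\Phi_{\mathbf x}$ and $\Phi_{\mathbf y}$, $$d(p_{\mathbf x},p_{\mathbf y})^2=\inf\Big\{\int_{\mathbb T^d}\|W_{\mathbf x}-W_{\mathbf y}\|_F^2\,\mathrm d\mu\ :\ W_{\mathbf x}W_{\mathbf x}^*=\Phi_{\mathbf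 x},\ W_{\mathbf y}W_{\mathbf y}^*=\Phi_{\mathbf y}\text{ almost everywhere}\Big\},$$ the infimum being over measurable $W_{\mathbf x},W_{\mathbf y}:\mathbb T^d\to\mathbb C^{m\times m}$, with $\|\cdot\|_F$ the Frobenius norm. -/

import Mathlib

open MeasureTheory ProbabilityTheory
open scoped MatrixOrder ComplexOrder

/-! ### Laws of random fields on `ℤ^d`

A random field on `ℤ^d` with values in `V` is described by its law, a measure on the path space
`(Fin d → ℤ) → V` with the product σ-algebra; the field itself is the coordinate process. -/

/-- The law of a Gaussian random field: all finite-dimensional distributions of the coordinate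
process are Gaussian (possibly degenerate). In particular `P` is a probability measure. -/
def IsGaussianField {d : ℕ} {V : Type*} [MeasurableSpace V] [TopologicalSpace V] [AddCommMonoid V]
    [Module ℝ V] (P : Measure ((Fin d → ℤ) → V)) : Prop :=
  IsGaussianProcess (fun (t : Fin d → ℤ) (z : (Fin d → ℤ) → V) => z t) P

/-- (Strict) stationarity: the law is invariant under all translations of `ℤ^d`. -/
def IsStationaryField {d : ℕ} {V : Type*} [MeasurableSpace V] (P : Measure ((Fin d → ℤ) → V)) :
    Prop :=
  ∀ s : Fin d → ℤ, P.map (fun z t => z (t + s)) = P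

/-- The field has zero mean. -/
def IsZeroMeanField {d m : ℕ} (P : Measure ((Fin d → ℤ) → EuclideanSpace ℝ (Fin m))) : Prop :=
  ∀ t : Fin d → ℤ, ∫ z, z t ∂P = 0

/-! ### Spectral densities on `𝕋^d = [0, 2π]^d` -/

/-- The normalized Lebesgue measure `dμ(ϑ) = (2π)^{-d} ∏ dϑ_k` on `[0, 2π]^d`. -/
noncomputable def torusMeasure (d : ℕ) : Measure (Fin d → ℝ) :=
  ENNReal.ofReal (((2 * Real.pi) ^ d)⁻¹) •
    volume.restrict (Set.Icc (0 : Fin d → ℝ) (fun _ => 2 * Real.pi))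

/-- The entrywise integral of a matrix-valued function on `𝕋^d`. -/
noncomputable def matrixTorusIntegral {d m : ℕ}
    (F : (Fin d → ℝ) → Matrix (Fin m) (Fin m) ℂ) : Matrix (Fin m) (Fin m) ℂ :=
  Matrix.of fun i j => ∫ θ, F θ i j ∂(torusMeasure d)

/-- `Φ` is the power spectral density of the zero-mean stationary field with law `P`: `Φ` is the
integrable function whose Fourier coefficients are the covariances
`R_t = E[x_{t+s} x_sᵀ]`, i.e. `R_t = ∫ Φ(ϑ) e^{j⟨ϑ,t⟩} dμ`; equivalently, `Φ` has the Fourier series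
`∑_t R_t e^{-j⟨ϑ,t⟩}`. -/
def IsSpectralDensity {d m : ℕ} (P : Measure ((Fin d → ℤ) → EuclideanSpace ℝ (Fin m)))
    (Φ : (Fin d → ℝ) → Matrix (Fin m) (Fin m) ℂ) : Prop :=
  (∀ i j, Integrable (fun θ => Φ θ i j) (torusMeasure d)) ∧
  ∀ (t s : Fin d → ℤ) (i j : Fin m),
    ((∫ z, z (t + s) i * z s j ∂P : ℝ) : ℂ) =
      ∫ θ, Φ θ i j * Complex.exp (Complex.I * ((∑ k, θ k * (t k : ℝ) : ℝ) : ℂ)) ∂(torusMeasure d)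

/-- `Φ` is bounded and coercive: it is Hermitian with `c I ≤ Φ ≤ C I` almost everywhere, for some
constants `c > 0` and `C`. -/
def IsBoundedCoercive {d m : ℕ} (Φ : (Fin d → ℝ) → Matrix (Fin m) (Fin m) ℂ) : Prop :=
  ∃ c C : ℝ, 0 < c ∧ ∀ᵐ θ ∂(torusMeasure d),
    (Φ θ - (c : ℂ) • (1 : Matrix (Fin m) (Fin m) ℂ)).PosSemidef ∧
    ((C : ℂ) • (1 : Matrix (Fin m) (Fin m) ℂ) - Φ θ).PosSemidef

/-! ### The optimal transport problem -/

/-- The admissible joint laws: laws of jointly Gaussian, jointly stationary pairs `(x, y)` whose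
marginals are `px` and `py`. -/
def gaussianCouplings {d m : ℕ} (px py : Measure ((Fin d → ℤ) → EuclideanSpace ℝ (Fin m))) :
    Set (Measure ((Fin d → ℤ) → EuclideanSpace ℝ (Fin m) × EuclideanSpace ℝ (Fin m))) :=
  {γ | IsGaussianField γ ∧ IsStationaryField γ ∧
    γ.map (fun z t => (z t).1) = px ∧ γ.map (fun z t => (z t).2) = py}

/-- The values `E ‖x_t - y_t‖²` at the site `t` over all admissible joint laws. -/
def transportCosts {d m : ℕ} (px py : Measure ((Fin d → ℤ) → EuclideanSpace ℝ (Fin m)))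
    (t : Fin d → ℤ) : Set ℝ :=
  {c | ∃ γ ∈ gaussianCouplings px py, c = ∫ z, ‖(z t).1 - (z t).2‖ ^ 2 ∂γ}

/-- The optimal transport distance `d(p_x, p_y)`, with
`d(p_x, p_y)² = inf E ‖x_t - y_t‖²` (by stationarity the site does not matter; take `t = 0`). -/
noncomputable def transportDist {d m : ℕ}
    (px py : Measure ((Fin d → ℤ) → EuclideanSpace ℝ (Fin m))) : ℝ :=
  Real.sqrt (sInf (transportCosts px py 0))

/-! ### The Hellinger distance between spectral densities -/

/-- `W` is a (measurable, square) spectral factor of `Φ`: `W W* = Φ` almost everywhere. -/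
def IsSpectralFactor {d m : ℕ} (Φ W : (Fin d → ℝ) → Matrix (Fin m) (Fin m) ℂ) : Prop :=
  (∀ i j, AEStronglyMeasurable (fun θ => W θ i j) (torusMeasure d)) ∧
  ∀ᵐ θ ∂(torusMeasure d), W θ * (W θ).conjTranspose = Φ θ

/-- The squared `L²` distances `∫ ‖W₁ - W₂‖_F² dμ` between spectral factors of `Φ₁` and `Φ₂`. -/
def factorCosts {d m : ℕ} (Φ₁ Φ₂ : (Fin d → ℝ) → Matrix (Fin m) (Fin m) ℂ) : Set ℝ :=
  {c | ∃ W₁ W₂, IsSpectralFactor Φ₁ W₁ ∧ IsSpectralFactor Φ₂ W₂ ∧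
    c = ∫ θ, ∑ i, ∑ j, ‖(W₁ θ - W₂ θ) i j‖ ^ 2 ∂(torusMeasure d)}

/-- The Hellinger distance between matrix-valued spectral densities: the smallest `L²` distance
between their spectral factors. -/
noncomputable def hellingerDist {d m : ℕ}
    (Φ₁ Φ₂ : (Fin d → ℝ) → Matrix (Fin m) (Fin m) ℂ) : ℝ :=
  Real.sqrt (sInf (factorCosts Φ₁ Φ₂))

/-- The integrand `Φ₁ + Φ₂ - 2 (Φ₂^{1/2} Φ₁ Φ₂^{1/2})^{1/2}`, with the positive semidefinite
square root of matrices. -/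
noncomputable def hellingerIntegrand {d m : ℕ}
    (Φ₁ Φ₂ : (Fin d → ℝ) → Matrix (Fin m) (Fin m) ℂ) (θ : Fin d → ℝ) :
    Matrix (Fin m) (Fin m) ℂ :=
  Φ₁ θ + Φ₂ θ - (2 : ℂ) • CFC.sqrt (CFC.sqrt (Φ₂ θ) * Φ₁ θ * CFC.sqrt (Φ₂ θ))

/-! At a fixed frequency write `A`, `D` for the values of `Φx`, `Φy` and `F = (D^{1/2} A
D^{1/2})^{1/2}`. The matrix `K = D^{-1/2} F D^{-1/2}` is positive definite, with `K D K = A` and `tr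
(K D) = tr F`. Its square root `S` balances the two densities: `tr (S⁻¹ A S⁻¹) = tr (S D S) = tr F`.
In both minimization problems the constraints fix the diagonal terms `tr A + tr D`, so only the
cross term varies; both infima are attained, with common value `∫ tr (A + D - 2F) dμ`.

Bound on the cross term. For factors `V V* = A`, `W W* = D`, expanding `0 ≤ ‖S⁻¹V - S W‖²` gives `Re
tr (V W*) ≤ tr F` (`re_trace_mul_conjTranspose_le`). For a coupling the same square is completed
after filtering: pass `x` through the filter `S⁻¹` and `y` through `S`. The filtered fields have
powers `∫ tr F`, and their cross-correlation is still `E⟨x, y⟩`, because `S* S⁻¹ = 1`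
(`two_mul_re_sum_inner_le`). This needs only a square integrable cross density, not positivity of a
joint spectral measure.

Attainment. Take `W = D^{1/2}`, `V = K D^{1/2}` for factors, and for fields let `x` be the output of
the filter `K` driven by `y` (`exists_optimal_process`). The output is real because `K` inherits the
conjugate symmetry of the densities. It is Gaussian because it lies in the closed real span of the
variables of `y`, and a limit in `L²` of centered Gaussians is Gaussian
(`isClosed_isRealCenteredGaussian`). Its law is `px` because a Gaussian law is determined by its
first two moments and `K D K = A`.

Boundedness and coercivity keep `(Φx, Φy)` in a compact set of positive definite pairs, on which
`F`, `K`, `S`, `S⁻¹` are continuous; hence all transfer functions are measurable and bounded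
(`memLp_top_of_continuousOn_posDefPairs`). -/

/-! ### Geometric mean, fidelity and the pointwise trace inequality -/

section MatrixGeometry

variable {n : Type*} [Fintype n] [DecidableEq n]

open scoped Matrix.Norms.L2Operator in
theorem Matrix.continuousOn_cfcSqrt :
    ContinuousOn (fun A : Matrix n n ℂ => CFC.sqrt A) {A | 0 ≤ A} := by
  have h : (fun A : Matrix n n ℂ => CFC.sqrt A) = fun A => cfc NNReal.sqrt A := by
    ext1 A; exact CFC.sqrt_eq_cfc
  rw [h]
  exact ContinuousOn.cfc_nnreal_of_mem_nhdsSet (s := Set.univ) (a := fun A : Matrix n n ℂ => A)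
    NNReal.sqrt (by simp) continuousOn_id (fun x hx => hx)
    NNReal.continuous_sqrt.continuousOn

/-- Hermitian matrices with `c ≤ A ≤ C`. -/
def Matrix.loewnerInterval (n : Type*) [Fintype n] [DecidableEq n] (c C : ℝ) : Set (Matrix n n ℂ) :=
  {A | (A - (c : ℂ) • (1 : Matrix n n ℂ)).PosSemidef ∧ ((C : ℂ) • (1 : Matrix n n ℂ) - A).PosSemidef}

theorem Matrix.posDef_of_mem_loewnerInterval {c C : ℝ} (hc : 0 < c) {A : Matrix n n ℂ}
    (hA : A ∈ Matrix.loewnerInterval n c C) : A.PosDef := by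
  have h1 : ((c : ℂ) • (1 : Matrix n n ℂ)).PosDef :=
    Matrix.PosDef.one.smul (by exact_mod_cast hc)
  simpa using Matrix.PosDef.posSemidef_add hA.1 h1

-- The cone of positive semidefinite matrices is closed, and `0 ≤ A ≤ C` bounds the operator norm of
-- `A`.
open scoped Matrix.Norms.L2Operator in
theorem Matrix.isCompact_loewnerInterval {c C : ℝ} (hc : 0 < c) :
    IsCompact (Matrix.loewnerInterval n c C) := by
  have : ProperSpace (Matrix n n ℂ) := FiniteDimensional.proper ℂ _
  have hps : IsClosed {A : Matrix n n ℂ | 0 ≤ A} := isClosed_Ici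
  refine Metric.isCompact_of_isClosed_isBounded ?_ ?_
  · have h1 : IsClosed ((fun A : Matrix n n ℂ => A - (c : ℂ) • (1 : Matrix n n ℂ)) ⁻¹' {A | 0 ≤ A}) :=
      hps.preimage (by fun_prop)
    have h2 : IsClosed ((fun A : Matrix n n ℂ => (C : ℂ) • (1 : Matrix n n ℂ) - A) ⁻¹' {A | 0 ≤ A}) :=
      hps.preimage (by fun_prop)
    have h3 : Matrix.loewnerInterval n c C =
        ((fun A : Matrix n n ℂ => A - (c : ℂ) • (1 : Matrix n n ℂ)) ⁻¹' {A | 0 ≤ A}) ∩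
        ((fun A : Matrix n n ℂ => (C : ℂ) • (1 : Matrix n n ℂ) - A) ⁻¹' {A | 0 ≤ A}) := by
      ext A
      simp only [Matrix.loewnerInterval, Set.mem_inter_iff, Set.mem_preimage, Set.mem_ofPred_eq,
        Matrix.nonneg_iff_posSemidef]
    exact h3 ▸ h1.inter h2
  -- `C` may be negative (in dimension zero, or when the interval is empty), so the radius is `max C
  -- 0`.
  · refine (Metric.isBounded_closedBall (x := (0 : Matrix n n ℂ)) (r := max C 0)).subset fun A hA => ?_
    rw [mem_closedBall_zero_iff,
      CStarAlgebra.norm_le_iff_le_algebraMap A (le_max_right _ _)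
        (Matrix.posDef_of_mem_loewnerInterval hc hA).posSemidef.nonneg]
    have h1 : A ≤ (C : ℂ) • (1 : Matrix n n ℂ) := Matrix.le_iff.2 hA.2
    refine h1.trans ?_
    rw [Matrix.le_iff, Algebra.algebraMap_eq_smul_one]
    have : (max C 0 : ℝ) • (1 : Matrix n n ℂ) - (C : ℂ) • (1 : Matrix n n ℂ)
        = ((max C 0 - C : ℝ) : ℂ) • (1 : Matrix n n ℂ) := by
      ext i j
      simp [sub_mul]
    rw [this]
    exact Matrix.PosSemidef.one.smul (by exact_mod_cast sub_nonneg.2 (le_max_left _ _))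

namespace Matrix

theorem PosDef.cfcSqrt {A : Matrix n n ℂ} (hA : A.PosDef) : (CFC.sqrt A).PosDef := by
  have h0 : (CFC.sqrt A).PosSemidef := Matrix.nonneg_iff_posSemidef.1 (CFC.sqrt_nonneg A)
  refine h0.posDef_iff_isUnit.2 ?_
  have h1 : CFC.sqrt A * CFC.sqrt A = A := CFC.sqrt_mul_sqrt_self A hA.posSemidef.nonneg
  have h2 : IsUnit (CFC.sqrt A * CFC.sqrt A) := h1.symm ▸ hA.isUnit
  rw [Matrix.isUnit_iff_isUnit_det, Matrix.det_mul] at h2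
  rw [Matrix.isUnit_iff_isUnit_det]
  exact isUnit_of_mul_isUnit_left h2

/-- The fidelity matrix `(D^{1/2} A D^{1/2})^{1/2}`. -/
noncomputable def fidelity (A D : Matrix n n ℂ) : Matrix n n ℂ :=
  CFC.sqrt (CFC.sqrt D * A * CFC.sqrt D)

/-- The geometric mean of `A` and `D⁻¹`, i.e. the positive solution `K` of `K D K = A`. -/
noncomputable def transportMap (A D : Matrix n n ℂ) : Matrix n n ℂ :=
  (CFC.sqrt D)⁻¹ * fidelity A D * (CFC.sqrt D)⁻¹

variable {A D : Matrix n n ℂ}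

theorem PosDef.sqrt_mul_mul_sqrt (hA : A.PosDef) (hD : D.PosDef) :
    (CFC.sqrt D * A * CFC.sqrt D).PosDef := by
  have hs := hD.cfcSqrt
  have h := hA.conjTranspose_mul_mul_same (B := CFC.sqrt D)
    (Matrix.mulVec_injective_iff_isUnit.2 hs.isUnit)
  rwa [hs.isHermitian.eq] at h

theorem PosDef.fidelity (hA : A.PosDef) (hD : D.PosDef) : (fidelity A D).PosDef :=
  (hA.sqrt_mul_mul_sqrt hD).cfcSqrt

theorem PosDef.transportMap (hA : A.PosDef) (hD : D.PosDef) : (transportMap A D).PosDef := by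
  have hs := hD.cfcSqrt.inv
  have h := (hA.fidelity hD).conjTranspose_mul_mul_same (B := (CFC.sqrt D)⁻¹)
    (Matrix.mulVec_injective_iff_isUnit.2 hs.isUnit)
  rwa [hs.isHermitian.eq] at h

theorem PosDef.isUnit_det' {M : Matrix n n ℂ} (hM : M.PosDef) : IsUnit M.det :=
  (Matrix.isUnit_iff_isUnit_det _).1 hM.isUnit

theorem sqrt_mul_transportMap_mul_sqrt (hD : D.PosDef) :
    CFC.sqrt D * transportMap A D * CFC.sqrt D = fidelity A D := by
  have hu := hD.cfcSqrt.isUnit_det'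
  rw [transportMap, Matrix.mul_assoc, Matrix.mul_assoc, Matrix.mul_assoc, Matrix.nonsing_inv_mul _ hu,
    Matrix.mul_one, ← Matrix.mul_assoc, Matrix.mul_nonsing_inv _ hu, Matrix.one_mul]

/-- With `R = D^{1/2}` one has `K R = R⁻¹ F` and `R K = F R⁻¹`, so `K R² K = R⁻¹ F² R⁻¹`, and `F² =
R A R`. This identity makes the filter `K` turn a field with density `D` into one with density `A`.
-/
theorem transportMap_mul_mul_transportMap (hA : A.PosDef) (hD : D.PosDef) :
    transportMap A D * D * transportMap A D = A := by
  have hu := hD.cfcSqrt.isUnit_det'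
  have hDD : CFC.sqrt D * CFC.sqrt D = D := CFC.sqrt_mul_sqrt_self D hD.posSemidef.nonneg
  have hF : fidelity A D * fidelity A D = CFC.sqrt D * A * CFC.sqrt D :=
    CFC.sqrt_mul_sqrt_self _ (hA.sqrt_mul_mul_sqrt hD).posSemidef.nonneg
  set R := CFC.sqrt D
  set F := fidelity A D
  have e1 : transportMap A D * R = R⁻¹ * F := by
    simp only [transportMap]
    change R⁻¹ * F * R⁻¹ * R = _
    rw [Matrix.mul_assoc, Matrix.nonsing_inv_mul _ hu, Matrix.mul_one]
  have e2 : R * transportMap A D = F * R⁻¹ := by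
    simp only [transportMap]
    change R * (R⁻¹ * F * R⁻¹) = _
    rw [← Matrix.mul_assoc, ← Matrix.mul_assoc, Matrix.mul_nonsing_inv _ hu, Matrix.one_mul]
  calc transportMap A D * D * transportMap A D
      = (transportMap A D * R) * (R * transportMap A D) := by
        rw [← hDD]; simp only [Matrix.mul_assoc]
    _ = R⁻¹ * (F * F) * R⁻¹ := by rw [e1, e2]; simp only [Matrix.mul_assoc]
    _ = (R⁻¹ * R) * A * (R * R⁻¹) := by rw [hF]; simp only [Matrix.mul_assoc]
    _ = A := by rw [Matrix.nonsing_inv_mul _ hu, Matrix.mul_nonsing_inv _ hu]; simp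

theorem trace_transportMap_mul (hD : D.PosDef) :
    (transportMap A D * D).trace = (fidelity A D).trace := by
  have hDD : CFC.sqrt D * CFC.sqrt D = D := CFC.sqrt_mul_sqrt_self D hD.posSemidef.nonneg
  rw [← sqrt_mul_transportMap_mul_sqrt hD, Matrix.trace_mul_comm (CFC.sqrt D * _),
    ← Matrix.mul_assoc, hDD, Matrix.trace_mul_comm]

/-- The square root of the transport map. -/
noncomputable def sqrtTransportMap (A D : Matrix n n ℂ) : Matrix n n ℂ :=
  CFC.sqrt (transportMap A D)

theorem PosDef.sqrtTransportMap (hA : A.PosDef) (hD : D.PosDef) : (sqrtTransportMap A D).PosDef :=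
  (hA.transportMap hD).cfcSqrt

theorem sqrtTransportMap_mul_self (hA : A.PosDef) (hD : D.PosDef) :
    sqrtTransportMap A D * sqrtTransportMap A D = transportMap A D :=
  CFC.sqrt_mul_sqrt_self _ (hA.transportMap hD).posSemidef.nonneg

theorem trace_sqrtTransportMap_mul_mul (hA : A.PosDef) (hD : D.PosDef) :
    (sqrtTransportMap A D * D * sqrtTransportMap A D).trace = (fidelity A D).trace := by
  rw [Matrix.trace_mul_comm, ← Matrix.mul_assoc, sqrtTransportMap_mul_self hA hD,
    trace_transportMap_mul hD]

/-- From `A = K D K` follows `K⁻¹ A = D K`, so the weight `S⁻¹` on `A` costs exactly as much as the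
weight `S` on `D`. This balance makes the completed square sharp. -/
theorem trace_inv_sqrtTransportMap_mul_mul (hA : A.PosDef) (hD : D.PosDef) :
    ((sqrtTransportMap A D)⁻¹ * A * (sqrtTransportMap A D)⁻¹).trace = (fidelity A D).trace := by
  have hK := (hA.transportMap hD).isUnit_det'
  have h : (transportMap A D)⁻¹ * A = D * transportMap A D := by
    calc (transportMap A D)⁻¹ * A
        = (transportMap A D)⁻¹ * (transportMap A D * D * transportMap A D) := by
          rw [transportMap_mul_mul_transportMap hA hD]
      _ = D * transportMap A D := by
          rw [Matrix.mul_assoc, Matrix.nonsing_inv_mul_cancel_left _ _ hK]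
  rw [Matrix.trace_mul_comm, ← Matrix.mul_assoc, ← Matrix.mul_inv_rev, sqrtTransportMap_mul_self hA hD,
    h, Matrix.trace_mul_comm, trace_transportMap_mul hD]

/-- The entrywise conjugate of a positive semidefinite matrix is its transpose, again positive
semidefinite; uniqueness of the square root concludes. Used to transfer the symmetry of real fields
to the optimal filter. -/
theorem cfcSqrt_map_conj {M : Matrix n n ℂ} (hM : M.PosSemidef) :
    CFC.sqrt (M.map (starRingEnd ℂ)) = (CFC.sqrt M).map (starRingEnd ℂ) := by
  have key : ∀ {N : Matrix n n ℂ}, N.PosSemidef → (N.map (starRingEnd ℂ)).PosSemidef := by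
    intro N hN
    have : N.map (starRingEnd ℂ) = Nᵀ := by
      ext i j
      have := congrFun (congrFun hN.isHermitian.eq j) i
      simpa using this
    rw [this]
    exact hN.transpose
  rw [CFC.sqrt_eq_iff _ _ (key hM).nonneg (key (Matrix.nonneg_iff_posSemidef.1 (CFC.sqrt_nonneg M))).nonneg,
    ← Matrix.map_mul, CFC.sqrt_mul_sqrt_self M hM.nonneg]

theorem transportMap_map_conj (hA : A.PosDef) (hD : D.PosDef) :
    transportMap (A.map (starRingEnd ℂ)) (D.map (starRingEnd ℂ)) =
      (transportMap A D).map (starRingEnd ℂ) := by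
  have hinv : ((CFC.sqrt D).map (starRingEnd ℂ))⁻¹ = ((CFC.sqrt D)⁻¹).map (starRingEnd ℂ) := by
    refine Matrix.inv_eq_left_inv ?_
    rw [← Matrix.map_mul, Matrix.nonsing_inv_mul _ hD.cfcSqrt.isUnit_det']
    simp
  rw [transportMap, fidelity, cfcSqrt_map_conj hD.posSemidef, ← Matrix.map_mul, ← Matrix.map_mul,
    cfcSqrt_map_conj (hA.sqrt_mul_mul_sqrt hD).posSemidef, hinv, ← Matrix.map_mul, ← Matrix.map_mul]
  rfl

/-- Pairs of positive definite matrices. -/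
def posDefPairs (n : Type*) [Fintype n] [DecidableEq n] : Set (Matrix n n ℂ × Matrix n n ℂ) :=
  {p | p.1.PosDef ∧ p.2.PosDef}

theorem continuousOn_inv_posDef {X : Type*} [TopologicalSpace X] {s : Set X} {f : X → Matrix n n ℂ}
    (hf : ContinuousOn f s) (h : ∀ x ∈ s, (f x).PosDef) : ContinuousOn (fun x => (f x)⁻¹) s := by
  simp only [Matrix.inv_def]
  have hd : ContinuousOn (fun x => (f x).det) s :=
    (Continuous.matrix_det continuous_id).comp_continuousOn hf
  have ha : ContinuousOn (fun x => (f x).adjugate) s :=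
    (Continuous.matrix_adjugate continuous_id).comp_continuousOn hf
  simp only [Ring.inverse_eq_inv']
  exact (hd.inv₀ fun x hx => (h x hx).isUnit_det'.ne_zero).smul ha

theorem continuousOn_fidelity :
    ContinuousOn (fun p : Matrix n n ℂ × Matrix n n ℂ => fidelity p.1 p.2) (posDefPairs n) := by
  have hs : ContinuousOn (fun p : Matrix n n ℂ × Matrix n n ℂ => CFC.sqrt p.2) (posDefPairs n) :=
    continuousOn_cfcSqrt.comp continuousOn_snd fun p hp => hp.2.posSemidef.nonneg
  refine continuousOn_cfcSqrt.comp ((hs.mul continuousOn_fst).mul hs) fun p hp => ?_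
  exact (hp.1.sqrt_mul_mul_sqrt hp.2).posSemidef.nonneg

theorem continuousOn_transportMap :
    ContinuousOn (fun p : Matrix n n ℂ × Matrix n n ℂ => transportMap p.1 p.2) (posDefPairs n) := by
  have hs : ContinuousOn (fun p : Matrix n n ℂ × Matrix n n ℂ => (CFC.sqrt p.2)⁻¹) (posDefPairs n) :=
    continuousOn_inv_posDef
      (continuousOn_cfcSqrt.comp continuousOn_snd fun p hp => hp.2.posSemidef.nonneg)
      fun p hp => hp.2.cfcSqrt
  exact (hs.mul continuousOn_fidelity).mul hs

theorem continuousOn_sqrtTransportMap :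
    ContinuousOn (fun p : Matrix n n ℂ × Matrix n n ℂ => sqrtTransportMap p.1 p.2)
      (posDefPairs n) :=
  continuousOn_cfcSqrt.comp continuousOn_transportMap
    fun _ hp => (hp.1.transportMap hp.2).posSemidef.nonneg

theorem continuousOn_inv_sqrtTransportMap :
    ContinuousOn (fun p : Matrix n n ℂ × Matrix n n ℂ => (sqrtTransportMap p.1 p.2)⁻¹)
      (posDefPairs n) :=
  continuousOn_inv_posDef continuousOn_sqrtTransportMap fun _ hp => hp.1.sqrtTransportMap hp.2

omit [DecidableEq n] in
theorem trace_mul_conjTranspose_eq_sum (M : Matrix n n ℂ) :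
    (M * M.conjTranspose).trace = ((∑ i, ∑ j, ‖M i j‖ ^ 2 : ℝ) : ℂ) := by
  simp [Matrix.trace, Matrix.mul_apply, Complex.mul_conj']

/-- Expand `0 ≤ ‖S⁻¹V - S W‖_F²`: each diagonal term is `tr F`, and cyclicity of the trace cancels
`S` against `S⁻¹` in the cross terms. -/
theorem re_trace_mul_conjTranspose_le {V W : Matrix n n ℂ} (hV : (V * V.conjTranspose).PosDef)
    (hW : (W * W.conjTranspose).PosDef) :
    (V * W.conjTranspose).trace.re ≤
      (fidelity (V * V.conjTranspose) (W * W.conjTranspose)).trace.re := by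
  set S := sqrtTransportMap (V * V.conjTranspose) (W * W.conjTranspose) with hS
  have hSp : S.PosDef := hV.sqrtTransportMap hW
  have hu := hSp.isUnit_det'
  have h1 := trace_sqrtTransportMap_mul_mul hV hW
  have h2 := trace_inv_sqrtTransportMap_mul_mul hV hW
  rw [← hS] at h1 h2
  have h3 := trace_mul_conjTranspose_eq_sum (S⁻¹ * V - S * W)
  have h4 : (S⁻¹ * V - S * W) * (S⁻¹ * V - S * W).conjTranspose
      = S⁻¹ * (V * V.conjTranspose) * S⁻¹ + S * (W * W.conjTranspose) * S
        - S⁻¹ * (V * W.conjTranspose) * S - S * (W * V.conjTranspose) * S⁻¹ := by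
    simp only [Matrix.conjTranspose_sub, Matrix.conjTranspose_mul, hSp.isHermitian.eq,
      hSp.inv.isHermitian.eq, Matrix.sub_mul, Matrix.mul_sub, Matrix.mul_assoc]
    abel
  have h5 : (S⁻¹ * (V * W.conjTranspose) * S).trace = (V * W.conjTranspose).trace := by
    rw [Matrix.trace_mul_comm, ← Matrix.mul_assoc, Matrix.mul_nonsing_inv _ hu, Matrix.one_mul]
  have h6 : (S * (W * V.conjTranspose) * S⁻¹).trace = star (V * W.conjTranspose).trace := by
    rw [Matrix.trace_mul_comm, ← Matrix.mul_assoc, Matrix.nonsing_inv_mul _ hu, Matrix.one_mul,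
      ← Matrix.trace_conjTranspose, Matrix.conjTranspose_mul, Matrix.conjTranspose_conjTranspose]
  rw [h4, Matrix.trace_sub, Matrix.trace_sub, Matrix.trace_add, h1, h2, h5, h6] at h3
  have h7 := congrArg Complex.re h3
  simp only [Complex.sub_re, Complex.add_re, Complex.ofReal_re, Complex.star_def,
    Complex.conj_re] at h7
  have h8 : 0 ≤ ∑ i, ∑ j, ‖(S⁻¹ * V - S * W) i j‖ ^ 2 := by positivity
  linarith

end Matrix

end MatrixGeometry

/-! ### Fourier analysis on the cube with its normalized measure -/

section TorusFourier

variable {d : ℕ}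

/-- The character `θ ↦ e^{i⟨θ,t⟩}`. -/
noncomputable def torusChar (t : Fin d → ℤ) (θ : Fin d → ℝ) : ℂ :=
  Complex.exp (Complex.I * ((∑ k, θ k * (t k : ℝ) : ℝ) : ℂ))

theorem torusChar_add (s t : Fin d → ℤ) (θ : Fin d → ℝ) :
    torusChar (s + t) θ = torusChar s θ * torusChar t θ := by
  simp only [torusChar, ← Complex.exp_add, ← mul_add, ← Complex.ofReal_add,
    ← Finset.sum_add_distrib, Pi.add_apply, Int.cast_add]

theorem torusChar_neg (t : Fin d → ℤ) (θ : Fin d → ℝ) :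
    torusChar (-t) θ = starRingEnd ℂ (torusChar t θ) := by
  simp [torusChar, ← Complex.exp_conj]

theorem torusChar_zero (θ : Fin d → ℝ) : torusChar 0 θ = 1 := by simp [torusChar]

theorem norm_torusChar (t : Fin d → ℤ) (θ : Fin d → ℝ) : ‖torusChar t θ‖ = 1 := by
  rw [torusChar, mul_comm, Complex.norm_exp_ofReal_mul_I]

theorem continuous_torusChar (t : Fin d → ℤ) : Continuous (torusChar t) := by
  unfold torusChar; fun_prop

/-- Since `t` is integral, the shift by `2π` is invisible to the character. Reflecting by `2π - θ`
rather than `-θ` maps the cube to itself. -/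
theorem torusChar_reflect (t : Fin d → ℤ) (θ : Fin d → ℝ) :
    torusChar t (fun k => 2 * Real.pi - θ k) = starRingEnd ℂ (torusChar t θ) := by
  have h : (∑ k, (2 * Real.pi - θ k) * (t k : ℝ) : ℝ)
      = ((∑ k, t k : ℤ) : ℝ) * (2 * Real.pi) + ∑ k, θ k * ((-t) k : ℤ) := by
    push_cast
    rw [Finset.sum_mul, ← Finset.sum_add_distrib]
    refine Finset.sum_congr rfl fun k _ => ?_
    simp
    ring
  rw [← torusChar_neg, torusChar, h, torusChar]
  push_cast
  rw [mul_add, Complex.exp_add]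
  have : Complex.I * (((∑ k, t k : ℤ) : ℂ) * (2 * Real.pi)) =
      ((∑ k, t k : ℤ) : ℂ) * (2 * Real.pi * Complex.I) := by ring
  push_cast at this
  rw [this]
  have h2 := Complex.exp_int_mul_two_pi_mul_I (∑ k, t k)
  push_cast at h2
  rw [h2, one_mul]

attribute [local instance] instMeasureSpaceUnitAddCircle

theorem torusMeasure_eq_map_smul :
    (volume.restrict {x : Fin d → ℝ | ∀ i, x i ∈ Set.Ioc ((0 : Fin d → ℝ) i) ((0 : Fin d → ℝ) i + 1)}).map
      (fun x => (2 * Real.pi) • x) = torusMeasure d := by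
  have hpi : (0 : ℝ) < 2 * Real.pi := by positivity
  have h1 : {x : Fin d → ℝ | ∀ i, x i ∈ Set.Ioc ((0 : Fin d → ℝ) i) ((0 : Fin d → ℝ) i + 1)} =
      (fun x : Fin d → ℝ => (2 * Real.pi) • x) ⁻¹'
        Set.pi Set.univ fun _ => Set.Ioc 0 (2 * Real.pi) := by
    ext x
    simp [hpi]
  have hm : MeasurableEmbedding (fun x : Fin d → ℝ => (2 * Real.pi) • x) :=
    (Homeomorph.smulOfNeZero (2 * Real.pi) hpi.ne').measurableEmbedding
  rw [h1, ← hm.restrict_map, Measure.map_addHaar_smul _ hpi.ne', Measure.restrict_smul,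
    torusMeasure]
  congr 1
  · simp [abs_of_pos hpi]
  · rw [← Set.pi_univ_Icc]
    exact Measure.restrict_congr_set (Measure.pi_Ioc_ae_eq_pi_Icc)

/-- Transports orthonormality and completeness of the Fourier system from `UnitAddTorus`: lift each
circle to `(0, 1]` and scale by `2π`; the faces of the cube are null. -/
theorem exists_measurePreserving_torusMeasure (d : ℕ) :
    ∃ σ : UnitAddTorus (Fin d) → (Fin d → ℝ),
      MeasurePreserving σ volume (torusMeasure d) ∧ MeasurableEmbedding σ ∧
      ∀ t x, torusChar t (σ x) = UnitAddTorus.mFourier t x := by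
  have hpi : (0 : ℝ) < 2 * Real.pi := by positivity
  have hm : MeasurableEmbedding (fun x : Fin d → ℝ => (2 * Real.pi) • x) :=
    (Homeomorph.smulOfNeZero (2 * Real.pi) hpi.ne').measurableEmbedding
  have hms : MeasurableSet {x : Fin d → ℝ | ∀ i, x i ∈ Set.Ioc ((0 : Fin d → ℝ) i) ((0 : Fin d → ℝ) i + 1)} :=
    MeasurableSet.univ_pi' fun i => measurableSet_Ioc
  have h1 := UnitAddTorus.measurePreserving_equivPiIoc (0 : Fin d → ℝ)
  have h2 := measurePreserving_subtype_coe (μa := (volume : Measure (Fin d → ℝ))) hms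
  have h3 : MeasurePreserving (fun x : Fin d → ℝ => (2 * Real.pi) • x) _ (torusMeasure d) :=
    ⟨hm.measurable, torusMeasure_eq_map_smul⟩
  refine ⟨_, h3.comp (h2.comp h1), hm.comp ((MeasurableEmbedding.subtype_coe hms).comp
    (MeasurableEquiv.measurableEmbedding _)), fun t x => ?_⟩
  have hx : ∀ k, x k = ((AddCircle.equivIoc 1 0 (x k)).1 : UnitAddCircle) := fun k =>
    ((AddCircle.equivIoc 1 0).symm_apply_apply (x k)).symm
  simp only [Function.comp_apply, UnitAddTorus.coe_measurableEquivPiIoc_apply, torusChar,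
    UnitAddTorus.mFourier, ContinuousMap.coe_mk]
  conv_rhs => enter [2, k]; rw [hx k, fourier_coe_apply]
  rw [← Complex.exp_sum]
  congr 1
  push_cast
  rw [Finset.mul_sum]
  refine Finset.sum_congr rfl fun k _ => ?_
  simp
  ring

instance : IsProbabilityMeasure (torusMeasure d) := by
  obtain ⟨σ, hσ, -⟩ := exists_measurePreserving_torusMeasure d
  have : IsProbabilityMeasure (volume : Measure UnitAddCircle) :=
    inferInstanceAs (IsProbabilityMeasure AddCircle.haarAddCircle)
  rw [← hσ.map_eq]
  exact Measure.isProbabilityMeasure_map hσ.measurable.aemeasurable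

theorem memLp_torusChar (t : Fin d → ℤ) (p : ENNReal) : MemLp (torusChar t) p (torusMeasure d) :=
  MemLp.of_bound (continuous_torusChar t).aestronglyMeasurable 1
    (Filter.Eventually.of_forall fun θ => (norm_torusChar t θ).le)

/-- The character `e^{i⟨θ,t⟩}` as an element of `L²`. -/
noncomputable def torusCharLp (t : Fin d → ℤ) : Lp ℂ 2 (torusMeasure d) :=
  (memLp_torusChar t 2).toLp _

theorem coeFn_torusCharLp (t : Fin d → ℤ) : torusCharLp t =ᵐ[torusMeasure d] torusChar t :=
  MemLp.coeFn_toLp _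

theorem integral_torusChar_mul_conj (s t : Fin d → ℤ) :
    ∫ θ, torusChar t θ * starRingEnd ℂ (torusChar s θ) ∂(torusMeasure d) = if s = t then 1 else 0 := by
  obtain ⟨σ, hσ, he, hc⟩ := exists_measurePreserving_torusMeasure d
  have h := orthonormal_iff_ite.1 (UnitAddTorus.orthonormal_mFourier (d := Fin d)) s t
  rw [← h, ContinuousMap.inner_toLp, ← hσ.integral_comp he]
  simp only [hc]

theorem orthonormal_torusCharLp : Orthonormal ℂ (torusCharLp (d := d)) := by
  rw [orthonormal_iff_ite]
  intro s t
  rw [← integral_torusChar_mul_conj s t, L2.inner_def]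
  refine integral_congr_ae ?_
  filter_upwards [coeFn_torusCharLp s, coeFn_torusCharLp t] with θ h1 h2
  rw [h1, h2]
  rfl

theorem ae_eq_zero_of_integral_torusChar {f : (Fin d → ℝ) → ℂ} (hf : MemLp f 2 (torusMeasure d))
    (h : ∀ t, ∫ θ, f θ * torusChar t θ ∂(torusMeasure d) = 0) : f =ᵐ[torusMeasure d] 0 := by
  obtain ⟨σ, hσ, he, hc⟩ := exists_measurePreserving_torusMeasure d
  have hg : MemLp (f ∘ σ) 2 (volume : Measure (UnitAddTorus (Fin d))) := hf.comp_measurePreserving hσ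
  have h0 : hg.toLp _ = 0 := by
    apply UnitAddTorus.mFourierBasis.repr.injective
    ext t
    rw [UnitAddTorus.mFourierBasis_repr, map_zero]
    have h1 := h (-t)
    rw [← hσ.integral_comp he] at h1
    simp only [hc] at h1
    rw [UnitAddTorus.mFourierCoeff]
    refine Eq.trans (integral_congr_ae ?_) h1
    filter_upwards [hg.coeFn_toLp] with x hx
    rw [hx, smul_eq_mul, mul_comm]
    rfl
  have h1 : f ∘ σ =ᵐ[volume] 0 := hg.coeFn_toLp.symm.trans ((Lp.eq_zero_iff_ae_eq_zero).1 h0)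
  rw [← hσ.map_eq]
  exact he.ae_map_iff.2 h1

theorem span_torusCharLp_orthogonal : (Submodule.span ℂ (Set.range (torusCharLp (d := d))))ᗮ = ⊥ := by
  rw [Submodule.eq_bot_iff]
  intro f hf
  rw [Submodule.mem_orthogonal] at hf
  have h : (f : (Fin d → ℝ) → ℂ) =ᵐ[torusMeasure d] 0 := by
    refine ae_eq_zero_of_integral_torusChar (Lp.memLp f) fun t => ?_
    rw [← hf _ (Submodule.subset_span ⟨-t, rfl⟩), L2.inner_def]
    refine integral_congr_ae ?_
    filter_upwards [coeFn_torusCharLp (-t)] with θ h1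
    rw [h1, torusChar_neg]
    simp [mul_comm]
  exact (Lp.eq_zero_iff_ae_eq_zero).2 h

/-- The characters form a Hilbert basis of `L²`. -/
noncomputable def torusBasis (d : ℕ) : HilbertBasis (Fin d → ℤ) ℂ (Lp ℂ 2 (torusMeasure d)) :=
  HilbertBasis.mkOfOrthogonalEqBot orthonormal_torusCharLp span_torusCharLp_orthogonal

theorem torusBasis_apply (t : Fin d → ℤ) : torusBasis d t = torusCharLp t := by
  simp [torusBasis]

theorem measurePreserving_reflect :
    MeasurePreserving (fun (θ : Fin d → ℝ) k => 2 * Real.pi - θ k)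
      (torusMeasure d) (torusMeasure d) := by
  have h1 : MeasurePreserving (fun θ : Fin d → ℝ => (fun _ => 2 * Real.pi) - θ) volume volume :=
    Measure.measurePreserving_sub_left _ _
  have h2 := h1.restrict_preimage (s := Set.Icc (0 : Fin d → ℝ) (fun _ => 2 * Real.pi))
    measurableSet_Icc
  have h3 : (fun θ : Fin d → ℝ => (fun _ => 2 * Real.pi) - θ) ⁻¹'
      Set.Icc (0 : Fin d → ℝ) (fun _ => 2 * Real.pi) = Set.Icc (0 : Fin d → ℝ) (fun _ => 2 * Real.pi) := by
    ext θ
    simp [Pi.le_def]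
  rw [h3] at h2
  exact h2.smul_measure _

theorem measurableEmbedding_reflect :
    MeasurableEmbedding (fun (θ : Fin d → ℝ) k => 2 * Real.pi - θ k) :=
  (Homeomorph.subLeft (fun _ : Fin d => 2 * Real.pi)).measurableEmbedding

end TorusFourier

/-! ### Spectral maps, cross densities and linear filters -/

section LinearFilters

variable {d : ℕ}

local notation "L²" => Lp ℂ 2 (torusMeasure d)

/-- Multiplication by a bounded function, as an operator on `L²`. -/
noncomputable def mulLp (φ : Lp ℂ ⊤ (torusMeasure d)) : L² →L[ℂ] L² :=
  (ContinuousLinearMap.mul ℂ ℂ).holderL (torusMeasure d) ⊤ 2 2 φ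

theorem coeFn_mulLp (φ : Lp ℂ ⊤ (torusMeasure d)) (f : L²) :
    mulLp φ f =ᵐ[torusMeasure d] fun θ => φ θ * f θ :=
  (ContinuousLinearMap.mul ℂ ℂ).coeFn_holder φ f

theorem continuousLinearMap_ext_torusCharLp {F : Type*} [NormedAddCommGroup F] [NormedSpace ℂ F]
    {A B : L² →L[ℂ] F} (h : ∀ t, A (torusCharLp t) = B (torusCharLp t)) : A = B := by
  refine ContinuousLinearMap.ext_on (s := Set.range (torusCharLp (d := d))) ?_ ?_
  · have h1 := (torusBasis d).dense_span
    have h2 : (⇑(torusBasis d)) = torusCharLp := funext torusBasis_apply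
    rw [h2] at h1
    exact (Submodule.dense_iff_topologicalClosure_eq_top).2 h1
  · rintro _ ⟨t, rfl⟩
    exact h t

theorem Lp_ext_inner_torusCharLp {f g : L²}
    (h : ∀ t, inner ℂ (torusCharLp t) f = inner ℂ (torusCharLp t) g) : f = g := by
  apply (torusBasis d).repr.injective
  ext t
  rw [HilbertBasis.repr_apply_apply, HilbertBasis.repr_apply_apply, torusBasis_apply, h]

/-- A bounded function as an element of `L²`. -/
noncomputable def bddLp {α : (Fin d → ℝ) → ℂ} (hα : MemLp α ⊤ (torusMeasure d)) : L² :=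
  (hα.mono_exponent le_top).toLp α

theorem coeFn_bddLp {α : (Fin d → ℝ) → ℂ} (hα : MemLp α ⊤ (torusMeasure d)) :
    bddLp hα =ᵐ[torusMeasure d] α := MemLp.coeFn_toLp _

theorem inner_torusCharLp_left (s : Fin d → ℤ) (f : L²) :
    inner ℂ (torusCharLp s) f = ∫ θ, f θ * torusChar (-s) θ ∂(torusMeasure d) := by
  rw [L2.inner_def]
  refine integral_congr_ae ?_
  filter_upwards [coeFn_torusCharLp s] with θ h1
  rw [h1, torusChar_neg]
  simp [mul_comm]

theorem inner_torusCharLp_mulLp (φ : Lp ℂ ⊤ (torusMeasure d)) (s t : Fin d → ℤ) :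
    inner ℂ (torusCharLp s) (mulLp φ (torusCharLp t)) =
      ∫ θ, φ θ * torusChar (t - s) θ ∂(torusMeasure d) := by
  rw [inner_torusCharLp_left]
  refine integral_congr_ae ?_
  filter_upwards [coeFn_mulLp φ (torusCharLp t), coeFn_torusCharLp t] with θ h1 h2
  rw [h1, h2, sub_eq_add_neg, torusChar_add, mul_assoc]

variable {H : Type*} [NormedAddCommGroup H] [InnerProductSpace ℂ H] [CompleteSpace H]

/-- A stationary sequence with bounded spectral density extends to a bounded operator on `L²`. -/
theorem exists_spectralMap {X : (Fin d → ℤ) → H} {φ : (Fin d → ℝ) → ℂ}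
    (hφ : MemLp φ ⊤ (torusMeasure d))
    (h : ∀ s t, inner ℂ (X s) (X t) = ∫ θ, φ θ * torusChar (t - s) θ ∂(torusMeasure d)) :
    ∃ J : L² →L[ℂ] H, ∀ t, J (torusCharLp t) = X t := by
  set M := mulLp (hφ.toLp φ) with hM
  have h' : ∀ s t, inner ℂ (X s) (X t) = inner ℂ (torusCharLp s) (M (torusCharLp t)) := by
    intro s t
    rw [h, hM, inner_torusCharLp_mulLp]
    refine integral_congr_ae ?_
    filter_upwards [hφ.coeFn_toLp] with θ h1
    rw [h1]
  set F := Finsupp.linearCombination ℂ X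
  set E := Finsupp.linearCombination ℂ (torusCharLp (d := d))
  -- On finite combinations the Gram form of `X` is the form of multiplication by `φ`. Hence `‖F p‖²
  -- ≤ ‖M‖ ‖E p‖²`, which makes the map `E p ↦ F p` well defined and bounded on the dense span of
  -- the characters.
  have key : ∀ p q, inner ℂ (F p) (F q) = inner ℂ (E p) (M (E q)) := by
    intro p q
    induction p using Finsupp.induction_linear with
    | zero => simp
    | add p p' hp hp' => simp only [map_add, inner_add_left, hp, hp']
    | single s c =>
      induction q using Finsupp.induction_linear with
      | zero => simp
      | add q q' hq hq' => simp only [map_add, inner_add_right, hq, hq']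
      | single t c' =>
        simp [F, E, Finsupp.linearCombination_single, inner_smul_left, inner_smul_right, h', mul_comm]
  have hbound : ∀ p, ‖F p‖ ≤ Real.sqrt ‖M‖ * ‖E p‖ := by
    intro p
    have h1 : ‖F p‖ ^ 2 ≤ ‖M‖ * ‖E p‖ ^ 2 := by
      calc ‖F p‖ ^ 2 = ‖inner ℂ (F p) (F p)‖ := by
            rw [inner_self_eq_norm_sq_to_K]; simp
        _ = ‖inner ℂ (E p) (M (E p))‖ := by rw [key]
        _ ≤ ‖E p‖ * (‖M‖ * ‖E p‖) :=
            (norm_inner_le_norm _ _).trans (by gcongr; exact M.le_opNorm _)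
        _ = ‖M‖ * ‖E p‖ ^ 2 := by ring
    rw [← abs_of_nonneg (norm_nonneg (F p))]
    refine Real.abs_le_sqrt h1 |>.trans ?_
    rw [Real.sqrt_mul (norm_nonneg _), Real.sqrt_sq (norm_nonneg _)]
  have hdense : DenseRange E := by
    have h1 := (torusBasis d).dense_span
    have h2 : (⇑(torusBasis d)) = torusCharLp := funext torusBasis_apply
    rw [h2, ← Finsupp.range_linearCombination] at h1
    have h3 := (Submodule.dense_iff_topologicalClosure_eq_top).2 h1
    rwa [LinearMap.coe_range] at h3
  refine ⟨F.extendOfNorm E, fun t => ?_⟩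
  have h1 := LinearMap.extendOfNorm_eq hdense ⟨_, hbound⟩ (Finsupp.single t 1)
  simpa [F, E, Finsupp.linearCombination_single] using h1

/-- Jointly stationary sequences which are images of bounded spectral maps have a square integrable
cross spectral density. -/
theorem exists_crossDensity {X Y : (Fin d → ℤ) → H} {JX JY : L² →L[ℂ] H}
    (hX : ∀ t, JX (torusCharLp t) = X t) (hY : ∀ t, JY (torusCharLp t) = Y t)
    (h : ∀ s t r, inner ℂ (Y (s + r)) (X (t + r)) = inner ℂ (Y s) (X t)) :
    ∃ a : (Fin d → ℝ) → ℂ, MemLp a 2 (torusMeasure d) ∧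
      ∀ s t, inner ℂ (Y s) (X t) = ∫ θ, a θ * torusChar (t - s) θ ∂(torusMeasure d) := by
  -- By joint stationarity `⟨Y s, X t⟩ = ⟨Y (s - t), X 0⟩`, and this is the Fourier coefficient of
  -- `JY* JX 1` at `s - t`.
  set f : L² := ContinuousLinearMap.adjoint JY (JX (torusCharLp 0)) with hf
  refine ⟨f, Lp.memLp f, fun s t => ?_⟩
  have h1 := h (s - t) 0 t
  rw [sub_add_cancel, zero_add] at h1
  rw [h1, ← neg_sub s t, ← inner_torusCharLp_left, hf, ContinuousLinearMap.adjoint_inner_right, hX, hY]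

/-- The operator `JY* JX` acts as multiplication by the cross density `a`. As `a` is only known to
be in `L²`, the products make sense here for bounded arguments. -/
theorem inner_spectralMap_bddLp {X Y : (Fin d → ℤ) → H} {JX JY : L² →L[ℂ] H}
    (hX : ∀ t, JX (torusCharLp t) = X t)
    (hY : ∀ t, JY (torusCharLp t) = Y t) {a : (Fin d → ℝ) → ℂ} (ha : MemLp a 2 (torusMeasure d))
    (h : ∀ s t, inner ℂ (Y s) (X t) = ∫ θ, a θ * torusChar (t - s) θ ∂(torusMeasure d))
    {α β : (Fin d → ℝ) → ℂ} (hα : MemLp α ⊤ (torusMeasure d)) (hβ : MemLp β ⊤ (torusMeasure d)) :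
    inner ℂ (JY (bddLp hα)) (JX (bddLp hβ)) =
      ∫ θ, starRingEnd ℂ (α θ) * β θ * a θ ∂(torusMeasure d) := by
  set A := ContinuousLinearMap.adjoint JY ∘L JX with hA
  have key : A (bddLp hβ) = mulLp (hβ.toLp β) (ha.toLp a) := by
    refine Lp_ext_inner_torusCharLp fun s => ?_
    -- For fixed `s`, the functional `f ↦ ⟨e_s, JY* JX f⟩` is represented by the `L²` function `conj
    -- a · e_s`: the two agree on characters and are continuous. Evaluating at `β` then gives the
    -- Fourier coefficients of `β a`.
    have hc : MemLp (fun θ => starRingEnd ℂ (a θ) * torusChar s θ) 2 (torusMeasure d) :=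
      MemLp.mul' (memLp_torusChar s ⊤) ha.star
    have e : (innerSL ℂ (torusCharLp s)) ∘L A = innerSL ℂ (hc.toLp _) := by
      refine continuousLinearMap_ext_torusCharLp fun t => ?_
      simp only [hA, ContinuousLinearMap.comp_apply, innerSL_apply_apply,
        ContinuousLinearMap.adjoint_inner_right, hX, hY, h]
      rw [L2.inner_def]
      refine integral_congr_ae ?_
      filter_upwards [hc.coeFn_toLp, coeFn_torusCharLp t] with θ h1 h2
      rw [h1, h2, sub_eq_add_neg, torusChar_add, torusChar_neg]
      simp
      ring
    have e2 := congrArg (fun L : L² →L[ℂ] ℂ => L (bddLp hβ)) e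
    simp only [ContinuousLinearMap.comp_apply, innerSL_apply_apply] at e2
    rw [e2, L2.inner_def, inner_torusCharLp_left]
    refine integral_congr_ae ?_
    filter_upwards [hc.coeFn_toLp, coeFn_bddLp hβ, coeFn_mulLp (hβ.toLp β) (ha.toLp a),
      hβ.coeFn_toLp, ha.coeFn_toLp] with θ h1 h2 h3 h4 h5
    rw [h1, h2, h3, h4, h5, torusChar_neg]
    simp
    ring
  rw [← ContinuousLinearMap.adjoint_inner_right]
  change inner ℂ _ (A (bddLp hβ)) = _
  rw [key, L2.inner_def]
  refine integral_congr_ae ?_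
  filter_upwards [coeFn_bddLp hα, coeFn_mulLp (hβ.toLp β) (ha.toLp a),
    hβ.coeFn_toLp, ha.coeFn_toLp] with θ h2 h3 h4 h5
  rw [h2, h3, h4, h5]
  simp
  ring

theorem integrable_conj_mul_mul {a : (Fin d → ℝ) → ℂ} (ha : MemLp a 2 (torusMeasure d))
    {α β : (Fin d → ℝ) → ℂ} (hα : MemLp α ⊤ (torusMeasure d)) (hβ : MemLp β ⊤ (torusMeasure d)) :
    Integrable (fun θ => starRingEnd ℂ (α θ) * β θ * a θ) (torusMeasure d) := by
  have h1 : MemLp (fun θ => starRingEnd ℂ (α θ) * β θ) ⊤ (torusMeasure d) := MemLp.mul' hβ hα.star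
  have h2 : MemLp (fun θ => starRingEnd ℂ (α θ) * β θ * a θ) 2 (torusMeasure d) := MemLp.mul' ha h1
  exact h2.integrable (by norm_num)

variable {m : ℕ}

/-- The linear filter with transfer function `W`, applied to a stationary field with spectral maps
`J`. -/
noncomputable def filterOutput (J : Fin m → L² →L[ℂ] H)
    {W : Fin m → (Fin d → ℝ) → ℂ} (hW : ∀ i, MemLp (W i) ⊤ (torusMeasure d)) : H :=
  ∑ i, J i (bddLp (hW i))

theorem integrable_filterOutput {a : Fin m → Fin m → (Fin d → ℝ) → ℂ}
    (ha : ∀ i j, MemLp (a i j) 2 (torusMeasure d))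
    {V W : Fin m → (Fin d → ℝ) → ℂ} (hV : ∀ i, MemLp (V i) ⊤ (torusMeasure d))
    (hW : ∀ i, MemLp (W i) ⊤ (torusMeasure d)) (i j : Fin m) :
    Integrable (fun θ => W i θ * a i j θ * starRingEnd ℂ (V j θ)) (torusMeasure d) := by
  have e : (fun θ => W i θ * a i j θ * starRingEnd ℂ (V j θ)) =
      fun θ => starRingEnd ℂ (V j θ) * W i θ * a i j θ := by ext θ; ring
  rw [e]
  exact integrable_conj_mul_mul (ha i j) (hV j) (hW i)

theorem inner_filterOutput {X Y : Fin m → (Fin d → ℤ) → H} {JX JY : Fin m → L² →L[ℂ] H}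
    (hX : ∀ i t, JX i (torusCharLp t) = X i t)
    (hY : ∀ i t, JY i (torusCharLp t) = Y i t) {a : Fin m → Fin m → (Fin d → ℝ) → ℂ}
    (ha : ∀ i j, MemLp (a i j) 2 (torusMeasure d))
    (h : ∀ i j s t, inner ℂ (Y j s) (X i t) =
      ∫ θ, a i j θ * torusChar (t - s) θ ∂(torusMeasure d))
    {V W : Fin m → (Fin d → ℝ) → ℂ} (hV : ∀ i, MemLp (V i) ⊤ (torusMeasure d))
    (hW : ∀ i, MemLp (W i) ⊤ (torusMeasure d)) :
    inner ℂ (filterOutput JY hV) (filterOutput JX hW) =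
      ∫ θ, ∑ i, ∑ j, W i θ * a i j θ * starRingEnd ℂ (V j θ) ∂(torusMeasure d) := by
  rw [integral_finsetSum _ fun i _ => integrable_finsetSum _ fun j _ =>
    integrable_filterOutput ha hV hW i j]
  rw [filterOutput, filterOutput, inner_sum]
  refine Finset.sum_congr rfl fun i _ => ?_
  rw [integral_finsetSum _ fun j _ => integrable_filterOutput ha hV hW i j, sum_inner]
  refine Finset.sum_congr rfl fun j _ => ?_
  rw [inner_spectralMap_bddLp (hX i) (hY j) (ha i j) (h i j)]
  congr 1 with θ
  ring

end LinearFilters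

/-! ### The bound on the cross-correlation -/

section CrossCovarianceBound

variable {d m : ℕ} {H : Type*} [NormedAddCommGroup H] [InnerProductSpace ℂ H] [CompleteSpace H]

/-- Filter `X` by `T` and `Y` by `S` and expand the squared distance of the outputs. The norms give
the two weighted traces, and the condition on `S* T` leaves the cross-correlation unchanged,
whatever the cross density is. -/
theorem two_mul_re_sum_inner_le {X Y : Fin m → (Fin d → ℤ) → H}
    {Φx Φy S T : (Fin d → ℝ) → Matrix (Fin m) (Fin m) ℂ}
    (hΦx : ∀ i j, MemLp (fun θ => Φx θ i j) ⊤ (torusMeasure d))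
    (hΦy : ∀ i j, MemLp (fun θ => Φy θ i j) ⊤ (torusMeasure d))
    (hX : ∀ i j s t, inner ℂ (X j s) (X i t) =
      ∫ θ, Φx θ i j * torusChar (t - s) θ ∂(torusMeasure d))
    (hY : ∀ i j s t, inner ℂ (Y j s) (Y i t) =
      ∫ θ, Φy θ i j * torusChar (t - s) θ ∂(torusMeasure d))
    (hXY : ∀ i j s t r, inner ℂ (Y j (s + r)) (X i (t + r)) = inner ℂ (Y j s) (X i t))
    (hS : ∀ i j, MemLp (fun θ => S θ i j) ⊤ (torusMeasure d))
    (hT : ∀ i j, MemLp (fun θ => T θ i j) ⊤ (torusMeasure d))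
    (hST : ∀ᵐ θ ∂(torusMeasure d), (S θ).conjTranspose * T θ = 1) :
    2 * (∑ i, inner ℂ (Y i 0) (X i 0)).re ≤
      (∫ θ, (T θ * Φx θ * (T θ).conjTranspose).trace ∂(torusMeasure d)).re +
      (∫ θ, (S θ * Φy θ * (S θ).conjTranspose).trace ∂(torusMeasure d)).re := by
  choose JX hJX using fun i => exists_spectralMap (hΦx i i) (hX i i)
  choose JY hJY using fun i => exists_spectralMap (hΦy i i) (hY i i)
  choose a ha hcross using fun i j => exists_crossDensity (hJX i) (hJY j) (hXY i j)
  have htop : ∀ {f : (Fin d → ℝ) → ℂ}, MemLp f ⊤ (torusMeasure d) → MemLp f 2 (torusMeasure d) :=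
    fun h => h.mono_exponent le_top
  have htrace : ∀ (W Φ : Matrix (Fin m) (Fin m) ℂ), (W * Φ * W.conjTranspose).trace =
      ∑ k, ∑ i, ∑ j, W k i * Φ i j * starRingEnd ℂ (W k j) := by
    intro W Φ
    simp only [Matrix.trace, Matrix.diag_apply, Matrix.mul_apply, Matrix.conjTranspose_apply,
      Finset.sum_mul]
    refine Finset.sum_congr rfl fun k _ => ?_
    rw [Finset.sum_comm]
    rfl
  have hsq : ∀ {Z : Fin m → (Fin d → ℤ) → H} {J : Fin m → Lp ℂ 2 (torusMeasure d) →L[ℂ] H}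
      {Φ W : (Fin d → ℝ) → Matrix (Fin m) (Fin m) ℂ}
      (hΦ : ∀ i j, MemLp (fun θ => Φ θ i j) ⊤ (torusMeasure d))
      (hZ : ∀ i j s t, inner ℂ (Z j s) (Z i t) =
        ∫ θ, Φ θ i j * torusChar (t - s) θ ∂(torusMeasure d))
      (hJ : ∀ i t, J i (torusCharLp t) = Z i t)
      (hW : ∀ i j, MemLp (fun θ => W θ i j) ⊤ (torusMeasure d)),
      ∑ k, ‖filterOutput J (hW k)‖ ^ 2 =
        (∫ θ, (W θ * Φ θ * (W θ).conjTranspose).trace ∂(torusMeasure d)).re := by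
    intro Z J Φ W hΦ hZ hJ hW
    simp only [htrace]
    rw [integral_finsetSum _ fun k _ => integrable_finsetSum _ fun i _ =>
      integrable_finsetSum _ fun j _ =>
        integrable_filterOutput (fun i j => htop (hΦ i j)) (hW k) (hW k) i j, Complex.re_sum]
    refine Finset.sum_congr rfl fun k _ => ?_
    rw [← inner_filterOutput hJ hJ (fun i j => htop (hΦ i j)) hZ (hW k) (hW k),
      inner_self_eq_norm_sq_to_K]
    norm_cast
  -- At each frequency `tr (T a S*) = tr (a S* T) = tr a`.
  have hcr : ∑ k, inner ℂ (filterOutput JY (hS k)) (filterOutput JX (hT k)) =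
      ∑ i, inner ℂ (Y i 0) (X i 0) := by
    simp only [inner_filterOutput hJX hJY ha hcross, hcross, sub_self, torusChar_zero, mul_one]
    rw [← integral_finsetSum _ fun k _ => integrable_finsetSum _ fun i _ =>
      integrable_finsetSum _ fun j _ => integrable_filterOutput ha (hS k) (hT k) i j,
      ← integral_finsetSum _ fun i _ => (ha i i).integrable (by norm_num)]
    refine integral_congr_ae ?_
    filter_upwards [hST] with θ hθ
    have h1 : ∀ i j, ∑ k, T θ k i * starRingEnd ℂ (S θ k j) =
        (1 : Matrix (Fin m) (Fin m) ℂ) j i := by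
      intro i j
      rw [← hθ]
      simp [Matrix.mul_apply, mul_comm]
    rw [Finset.sum_comm]
    refine Finset.sum_congr rfl fun i _ => ?_
    rw [Finset.sum_comm]
    have h2 : ∀ j, ∑ k, T θ k i * a i j θ * starRingEnd ℂ (S θ k j) =
        a i j θ * (1 : Matrix (Fin m) (Fin m) ℂ) j i := by
      intro j
      rw [← h1, Finset.mul_sum]
      exact Finset.sum_congr rfl fun k _ => by ring
    simp [h2, Matrix.one_apply]
  rw [← hcr, ← hsq hΦx hX hJX hT, ← hsq hΦy hY hJY hS, Complex.re_sum, Finset.mul_sum,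
    ← Finset.sum_add_distrib]
  refine Finset.sum_le_sum fun k _ => ?_
  have h1 := norm_sub_sq (𝕜 := ℂ) (filterOutput JY (hS k)) (filterOutput JX (hT k))
  have h2 : 0 ≤ ‖filterOutput JY (hS k) - filterOutput JX (hT k)‖ ^ 2 := by positivity
  have h3 : RCLike.re (inner ℂ (filterOutput JY (hS k)) (filterOutput JX (hT k))) =
    (inner ℂ (filterOutput JY (hS k)) (filterOutput JX (hT k))).re := rfl
  linarith

end CrossCovarianceBound

/-! ### Measurability and boundedness of the transfer functions -/

section BoundedTransferFunctions

variable {d m : ℕ}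

/-- Nothing is known about `g` off `k`, but the law of `f` is carried by `k`, so continuity there
suffices for measurability; compactness gives the bound. -/
theorem memLp_top_of_continuousOn_isCompact {T E : Type*} [MeasurableSpace T] {ν : Measure T}
    [TopologicalSpace E] [TopologicalSpace.PseudoMetrizableSpace E] [T2Space E]
    {k : Set E} (hk : IsCompact k) {f : T → E} (hf : AEStronglyMeasurable f ν)
    (hfk : ∀ᵐ θ ∂ν, f θ ∈ k) {g : E → ℂ} (hg : ContinuousOn g k) :
    MemLp (fun θ => g (f θ)) ⊤ ν := by
  borelize E
  obtain ⟨C, hC⟩ := hk.exists_bound_of_continuousOn hg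
  have hfm : AEMeasurable f ν := hf.aemeasurable
  have h1 : (ν.map f).restrict k = ν.map f := by
    refine Measure.restrict_eq_self_of_ae_mem ?_
    exact (ae_map_iff (p := (· ∈ k)) hfm hk.measurableSet).2 hfk
  have h2 : AEStronglyMeasurable g (ν.map f) := by
    rw [← h1]
    exact hg.aestronglyMeasurable hk.measurableSet
  refine memLp_top_of_bound (h2.comp_aemeasurable hfm) C ?_
  filter_upwards [hfk] with θ hθ using hC _ hθ

/-- The matrix functions that are bounded and coercive up to null sets. -/
theorem IsBoundedCoercive.exists_mem_loewnerInterval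
    {Φ : (Fin d → ℝ) → Matrix (Fin m) (Fin m) ℂ} (h : IsBoundedCoercive Φ) :
    ∃ c C : ℝ, 0 < c ∧ ∀ᵐ θ ∂(torusMeasure d), Φ θ ∈ Matrix.loewnerInterval (Fin m) c C := h

theorem IsBoundedCoercive.posDef {Φ : (Fin d → ℝ) → Matrix (Fin m) (Fin m) ℂ}
    (h : IsBoundedCoercive Φ) : ∀ᵐ θ ∂(torusMeasure d), (Φ θ).PosDef := by
  obtain ⟨c, C, hc, h⟩ := h.exists_mem_loewnerInterval
  filter_upwards [h] with θ hθ using Matrix.posDef_of_mem_loewnerInterval hc hθ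

theorem memLp_top_of_continuousOn_posDefPairs {Φx Φy : (Fin d → ℝ) → Matrix (Fin m) (Fin m) ℂ}
    (hx : ∀ i j, AEStronglyMeasurable (fun θ => Φx θ i j) (torusMeasure d))
    (hy : ∀ i j, AEStronglyMeasurable (fun θ => Φy θ i j) (torusMeasure d))
    (hbx : IsBoundedCoercive Φx) (hby : IsBoundedCoercive Φy)
    {F : Matrix (Fin m) (Fin m) ℂ × Matrix (Fin m) (Fin m) ℂ → Matrix (Fin m) (Fin m) ℂ}
    (hF : ContinuousOn F (Matrix.posDefPairs (Fin m))) (i j : Fin m) :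
    MemLp (fun θ => F (Φx θ, Φy θ) i j) ⊤ (torusMeasure d) := by
  obtain ⟨c, C, hc, hx'⟩ := hbx.exists_mem_loewnerInterval
  obtain ⟨c', C', hc', hy'⟩ := hby.exists_mem_loewnerInterval
  have hmeas : ∀ {Φ : (Fin d → ℝ) → Matrix (Fin m) (Fin m) ℂ},
      (∀ i j, AEStronglyMeasurable (fun θ => Φ θ i j) (torusMeasure d)) →
      AEStronglyMeasurable Φ (torusMeasure d) := by
    intro Φ h
    have : AEMeasurable (β := Fin m → Fin m → ℂ) Φ (torusMeasure d) :=
      aemeasurable_pi_lambda _ fun i => aemeasurable_pi_lambda _ fun j => (h i j).aemeasurable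
    exact this.aestronglyMeasurable
  have : TopologicalSpace.PseudoMetrizableSpace (Matrix (Fin m) (Fin m) ℂ) :=
    inferInstanceAs (TopologicalSpace.PseudoMetrizableSpace (Fin m → Fin m → ℂ))
  refine memLp_top_of_continuousOn_isCompact (g := fun p => F p i j)
    ((Matrix.isCompact_loewnerInterval (C := C) hc).prod
      (Matrix.isCompact_loewnerInterval (C := C') hc'))
    ((hmeas hx).prodMk (hmeas hy)) ?_ ?_
  · filter_upwards [hx', hy'] with θ h1 h2 using ⟨h1, h2⟩
  · have h1 : ContinuousOn F (Matrix.loewnerInterval (Fin m) c C ×ˢ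
        Matrix.loewnerInterval (Fin m) c' C') := hF.mono fun p hp =>
      ⟨Matrix.posDef_of_mem_loewnerInterval hc hp.1, Matrix.posDef_of_mem_loewnerInterval hc' hp.2⟩
    exact (Continuous.matrix_elem continuous_id i j).comp_continuousOn h1

end BoundedTransferFunctions

/-! ### Closedness of real centered Gaussian variables in `L²` -/

section GaussianClosure

variable {Ω : Type*} [MeasurableSpace Ω] {P : Measure Ω} [IsProbabilityMeasure P]

omit [IsProbabilityMeasure P] in
theorem norm_sq_eq_integral_norm_sq (Z : Lp ℂ 2 P) : ‖Z‖ ^ 2 = ∫ ω, ‖Z ω‖ ^ 2 ∂P := by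
  have h := inner_self_eq_norm_sq_to_K (𝕜 := ℂ) Z
  rw [L2.inner_def] at h
  have h2 : ∀ ω, inner ℂ (Z ω) (Z ω) = ((‖Z ω‖ ^ 2 : ℝ) : ℂ) := fun ω => by
    rw [inner_self_eq_norm_sq_to_K]; simp
  simp only [h2, integral_complex_ofReal] at h
  refine Complex.ofReal_injective (h.trans ?_).symm
  simp

theorem integral_norm_le_norm (Z : Lp ℂ 2 P) : ∫ ω, ‖Z ω‖ ∂P ≤ ‖Z‖ := by
  rw [integral_norm_eq_lintegral_enorm (Lp.aestronglyMeasurable Z), ← eLpNorm_one_eq_lintegral_enorm,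
    Lp.norm_def]
  exact ENNReal.toReal_mono (Lp.eLpNorm_ne_top Z)
    (eLpNorm_le_eLpNorm_of_exponent_le (by norm_num) (Lp.aestronglyMeasurable Z))

theorem norm_exp_I_mul_sub_exp_I_mul_le (a b : ℝ) :
    ‖Complex.exp (Complex.I * a) - Complex.exp (Complex.I * b)‖ ≤ |a - b| := by
  have h : Complex.exp (Complex.I * a) - Complex.exp (Complex.I * b) =
      Complex.exp (Complex.I * b) * (Complex.exp (Complex.I * ((a - b : ℝ) : ℂ)) - 1) := by
    rw [mul_sub, ← Complex.exp_add, mul_one]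
    push_cast
    congr 2
    ring
  rw [h, norm_mul, Complex.norm_exp_I_mul_ofReal, one_mul]
  exact Real.norm_exp_I_mul_ofReal_sub_one_le

theorem integrable_exp_I_mul {u : Ω → ℝ} (hu : AEStronglyMeasurable u P) :
    Integrable (fun ω => Complex.exp (Complex.I * (u ω : ℝ))) P := by
  refine Integrable.of_bound (C := 1) ?_ (Filter.Eventually.of_forall fun ω => ?_)
  · exact (by fun_prop : Continuous fun x : ℝ => Complex.exp (Complex.I * x)).comp_aestronglyMeasurable hu
  · rw [Complex.norm_exp_I_mul_ofReal]

omit [IsProbabilityMeasure P] in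
theorem aestronglyMeasurable_re (Z : Lp ℂ 2 P) : AEStronglyMeasurable (fun ω => (Z ω).re) P :=
  Complex.continuous_re.comp_aestronglyMeasurable (Lp.aestronglyMeasurable Z)

/-- The map is `|s|`-Lipschitz, since `|e^{ia} - e^{ib}| ≤ |a - b|` and the `L¹` norm is at most the
`L²` norm. -/
theorem continuous_integral_exp_re (s : ℝ) :
    Continuous fun Z : Lp ℂ 2 P => ∫ ω, Complex.exp (Complex.I * (s * (Z ω).re : ℝ)) ∂P := by
  refine (LipschitzWith.of_dist_le_mul (K := ⟨|s|, abs_nonneg s⟩) fun Z W => ?_).continuous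
  have hm : ∀ Z : Lp ℂ 2 P, AEStronglyMeasurable (fun ω => s * (Z ω).re) P := fun Z =>
    (aestronglyMeasurable_re Z).const_mul s
  rw [dist_eq_norm, dist_eq_norm,
    ← integral_sub (integrable_exp_I_mul (hm Z)) (integrable_exp_I_mul (hm W))]
  refine (norm_integral_le_integral_norm _).trans ?_
  change _ ≤ |s| * ‖Z - W‖
  refine le_trans ?_ (mul_le_mul_of_nonneg_left (integral_norm_le_norm (Z - W)) (abs_nonneg s))
  rw [← integral_const_mul]
  refine integral_mono_ae
    ((integrable_exp_I_mul (hm Z)).sub (integrable_exp_I_mul (hm W))).norm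
    (((Lp.memLp (Z - W)).integrable (by norm_num)).norm.const_mul _) ?_
  filter_upwards [Lp.coeFn_sub Z W] with ω h
  refine (norm_exp_I_mul_sub_exp_I_mul_le _ _).trans ?_
  rw [h, ← mul_sub, abs_mul, ← Complex.sub_re]
  exact mul_le_mul_of_nonneg_left (Complex.abs_re_le_norm _) (abs_nonneg s)

/-- A square integrable variable which is almost surely real, centered and Gaussian. -/
def IsRealCenteredGaussian (Z : Lp ℂ 2 P) : Prop :=
  (∀ᵐ ω ∂P, (Z ω).im = 0) ∧ P.map (fun ω => (Z ω).re) = gaussianReal 0 (‖Z‖₊ ^ 2)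

/-- Characteristic functions turn the law into a family of equations continuous in `Z`. For a
centered real variable the variance is `‖Z‖²`, so no convergence of variances has to be tracked
separately. -/
theorem isRealCenteredGaussian_iff (Z : Lp ℂ 2 P) : IsRealCenteredGaussian Z ↔
    Complex.imCLM.compLp Z = 0 ∧
    ∀ s : ℝ, ∫ ω, Complex.exp (Complex.I * (s * (Z ω).re : ℝ)) ∂P =
      Complex.exp (-(‖Z‖ ^ 2 * s ^ 2 / 2 : ℝ)) := by
  have h1 : (∀ᵐ ω ∂P, (Z ω).im = 0) ↔ Complex.imCLM.compLp Z = 0 := by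
    rw [Lp.eq_zero_iff_ae_eq_zero]
    have h := Complex.imCLM.coeFn_compLp Z
    constructor
    · intro h2
      filter_upwards [h, h2] with ω h3 h4
      rw [h3]; simpa using h4
    · intro h2
      filter_upwards [h, h2] with ω h3 h4
      rw [h3] at h4; simpa using h4
  have hm := aestronglyMeasurable_re Z
  have : IsProbabilityMeasure (P.map fun ω => (Z ω).re) :=
    Measure.isProbabilityMeasure_map hm.aemeasurable
  have h2 : ∀ s : ℝ, charFun (P.map fun ω => (Z ω).re) s =
      ∫ ω, Complex.exp (Complex.I * (s * (Z ω).re : ℝ)) ∂P := by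
    intro s
    rw [charFun_apply_real, integral_map hm.aemeasurable (by fun_prop)]
    congr 1 with ω
    push_cast
    ring_nf
  have h3 : ∀ s : ℝ, charFun (gaussianReal 0 (‖Z‖₊ ^ 2)) s =
      Complex.exp (-(‖Z‖ ^ 2 * s ^ 2 / 2 : ℝ)) := by
    intro s
    rw [charFun_gaussianReal]
    congr 1
    push_cast
    simp
  refine and_congr h1 ⟨fun h s => by rw [← h2, h, h3], fun h => Measure.ext_of_charFun ?_⟩
  ext s
  rw [h2, h, h3]

theorem isClosed_isRealCenteredGaussian : IsClosed {Z : Lp ℂ 2 P | IsRealCenteredGaussian Z} := by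
  simp only [isRealCenteredGaussian_iff, Set.ofPred_and, Set.ofPred_forall]
  refine IsClosed.inter ?_ (isClosed_iInter fun s => ?_)
  · exact isClosed_eq (Complex.imCLM.compLpL 2 P).continuous continuous_const
  · exact isClosed_eq (continuous_integral_exp_re s) (by fun_prop)

omit [IsProbabilityMeasure P] in
theorem isRealCenteredGaussian_of_ae_eq {Z : Lp ℂ 2 P} {u : Ω → ℝ}
    (h : Z =ᵐ[P] fun ω => (u ω : ℂ)) (hu : HasGaussianLaw u P) (h0 : ∫ ω, u ω ∂P = 0) :
    IsRealCenteredGaussian Z := by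
  refine ⟨by filter_upwards [h] with ω hω; simp [hω], ?_⟩
  have h1 : P.map (fun ω => (Z ω).re) = P.map u := by
    refine Measure.map_congr ?_
    filter_upwards [h] with ω hω
    simp [hω]
  have h2 : ‖Z‖ ^ 2 = Var[u; P] := by
    rw [variance_of_integral_eq_zero hu.aemeasurable h0, norm_sq_eq_integral_norm_sq]
    refine integral_congr_ae ?_
    filter_upwards [h] with ω hω
    simp [hω]
  rw [h1, hu.map_eq_gaussianReal, h0, ← h2]
  congr 1
  ext
  simp

/-- The closed real span in `L²` of the variables `X k`. -/
noncomputable def gaussianSpace {κ : Type*} (X : κ → Lp ℂ 2 P) : Submodule ℝ (Lp ℂ 2 P) :=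
  (Submodule.span ℝ (Set.range X)).topologicalClosure

omit [IsProbabilityMeasure P] in
theorem coeFn_sum_smul {κ : Type*} {X : κ → Lp ℂ 2 P} {x : κ → Ω → ℝ}
    (hX : ∀ k, X k =ᵐ[P] fun ω => (x k ω : ℂ)) (c : κ → ℝ) (I : Finset κ) :
    (∑ k ∈ I, c k • X k : Lp ℂ 2 P) =ᵐ[P] fun ω => ((∑ k ∈ I, c k * x k ω : ℝ) : ℂ) := by
  classical
  induction I using Finset.induction_on with
  | empty =>
    filter_upwards [Lp.coeFn_zero ℂ 2 P] with ω h
    simp only [Finset.sum_empty, h]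
    simp
  | insert k I hk ih =>
    rw [Finset.sum_insert hk]
    filter_upwards [Lp.coeFn_add (c k • X k) (∑ k ∈ I, c k • X k), Lp.coeFn_smul (c k) (X k),
      hX k, ih] with ω h1 h2 h3 h4
    rw [h1, Pi.add_apply, h2, Pi.smul_apply, h3, h4, Finset.sum_insert hk]
    simp

theorem isRealCenteredGaussian_of_mem_gaussianSpace {κ : Type*} {X : κ → Lp ℂ 2 P} {x : κ → Ω → ℝ}
    (hX : ∀ k, X k =ᵐ[P] fun ω => (x k ω : ℂ)) (hx : IsGaussianProcess x P)
    (h0 : ∀ k, ∫ ω, x k ω ∂P = 0) {Z : Lp ℂ 2 P} (hZ : Z ∈ gaussianSpace X) :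
    IsRealCenteredGaussian Z := by
  refine closure_minimal (s := (Submodule.span ℝ (Set.range X) : Set (Lp ℂ 2 P))) ?_
    isClosed_isRealCenteredGaussian hZ
  intro W hW
  obtain ⟨c, rfl⟩ := Finsupp.mem_span_range_iff_exists_finsupp.1 hW
  refine isRealCenteredGaussian_of_ae_eq (coeFn_sum_smul hX c c.support) ?_ ?_
  · simpa using (hx.smul c).hasGaussianLaw_fun_sum (I := c.support)
  · rw [integral_finsetSum _ fun k _ => ((hx.hasGaussianLaw_eval k).integrable.const_mul _)]
    simp [integral_const_mul, h0]

omit [IsProbabilityMeasure P] in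
theorem IsRealCenteredGaussian.hasGaussianLaw {Z : Lp ℂ 2 P} (h : IsRealCenteredGaussian Z) :
    HasGaussianLaw (fun ω => (Z ω).re) P :=
  ⟨h.2 ▸ inferInstance⟩

omit [IsProbabilityMeasure P] in
theorem IsRealCenteredGaussian.integral_re {Z : Lp ℂ 2 P} (h : IsRealCenteredGaussian Z) :
    ∫ ω, (Z ω).re ∂P = 0 := by
  have h1 := integral_map (μ := P) (φ := fun ω => (Z ω).re) (f := fun x : ℝ => x)
    (aestronglyMeasurable_re Z).aemeasurable (by fun_prop)
  rw [← h1, h.2, integral_id_gaussianReal]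

omit [IsProbabilityMeasure P] in
theorem ofReal_integral_re_mul_re {Z W : Lp ℂ 2 P} (hZ : ∀ᵐ ω ∂P, (Z ω).im = 0)
    (hW : ∀ᵐ ω ∂P, (W ω).im = 0) :
    ((∫ ω, (Z ω).re * (W ω).re ∂P : ℝ) : ℂ) = inner ℂ W Z := by
  rw [← integral_complex_ofReal, L2.inner_def]
  refine integral_congr_ae ?_
  filter_upwards [hZ, hW] with ω h1 h2
  have e1 : Z ω = ((Z ω).re : ℂ) := Complex.ext (by simp) (by simp [h1])
  have e2 : W ω = ((W ω).re : ℂ) := Complex.ext (by simp) (by simp [h2])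
  rw [e1, e2]
  simp

end GaussianClosure

/-! ### Laws and construction of Gaussian fields -/

section GaussianFields

variable {T V κ : Type*} [Fintype κ] [NormedAddCommGroup V] [NormedSpace ℝ V]
  [MeasurableSpace V] [BorelSpace V] [SecondCountableTopology V] [CompleteSpace V]

omit [MeasurableSpace V] [BorelSpace V] [SecondCountableTopology V] [CompleteSpace V] in
theorem strongDual_pi_apply_eq_sum {I : Type*} [Fintype I] [DecidableEq I] {ℓ : κ → V →L[ℝ] ℝ}
    {b : κ → V} (hb : ∀ v, ∑ k, ℓ k v • b k = v) (L : StrongDual ℝ (I → V)) (v : I → V) :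
    L v = ∑ p : I × κ, L (Pi.single p.1 (b p.2)) * ℓ p.2 (v p.1) := by
  rw [Fintype.sum_prod_type]
  conv_lhs => rw [← Finset.univ_sum_single v, map_sum]
  refine Finset.sum_congr rfl fun i _ => ?_
  conv_lhs => rw [← hb (v i)]
  have h : (Pi.single i (∑ k, ℓ k (v i) • b k) : I → V) =
      ∑ k, ℓ k (v i) • (Pi.single i (b k) : I → V) := by
    ext j
    by_cases hj : j = i
    · subst hj; simp
    · simp [hj]
  rw [h, map_sum]
  refine Finset.sum_congr rfl fun k _ => ?_
  rw [map_smul, smul_eq_mul, mul_comm]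

/-- A functional of finitely many sites is a combination of coordinates, so its mean and variance,
hence its Gaussian characteristic function, are determined by the given moments. Finite-dimensional
laws determine the measure. -/
theorem ProbabilityTheory.IsGaussianProcess.measure_ext {P Q : Measure (T → V)}
    (hP : IsGaussianProcess (fun t (z : T → V) => z t) P)
    (hQ : IsGaussianProcess (fun t (z : T → V) => z t) Q)
    {ℓ : κ → V →L[ℝ] ℝ} {b : κ → V} (hb : ∀ v, ∑ k, ℓ k v • b k = v)
    (hmean : ∀ t k, ∫ z, ℓ k (z t) ∂P = ∫ z, ℓ k (z t) ∂Q)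
    (hcov : ∀ s t k l, ∫ z, ℓ k (z s) * ℓ l (z t) ∂P = ∫ z, ℓ k (z s) * ℓ l (z t) ∂Q) : P = Q := by
  classical
  have := hP.isProbabilityMeasure
  have := hQ.isProbabilityMeasure
  have hI : ∀ I : Finset T, P.map I.restrict = Q.map I.restrict := by
    intro I
    have hPI : HasGaussianLaw (fun z : T → V => I.restrict z) P := hP.hasGaussianLaw I
    have hQI : HasGaussianLaw (fun z : T → V => I.restrict z) Q := hQ.hasGaussianLaw I
    have := hPI.isGaussian_map
    have := hQI.isGaussian_map
    refine Measure.ext_of_charFunDual ?_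
    ext L
    have e : ∀ z : T → V, (⇑L ∘ fun z : T → V => I.restrict z) z =
        ∑ p : I × κ, L (Pi.single p.1 (b p.2)) * ℓ p.2 (z p.1) := fun z =>
      strongDual_pi_apply_eq_sum hb L _
    have hintegrable : ∀ (ν : Measure (T → V)), IsGaussianProcess (fun t (z : T → V) => z t) ν →
        ∀ t k, MemLp (fun z : T → V => ℓ k (z t)) 2 ν := fun ν hR t k =>
      ((hR.hasGaussianLaw_eval t).map_fun (ℓ k)).memLp_two
    have hm : ∀ (ν : Measure (T → V)), IsGaussianProcess (fun t (z : T → V) => z t) ν →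
        IsProbabilityMeasure ν →
        ∫ z, (⇑L ∘ fun z : T → V => I.restrict z) z ∂ν =
          ∑ p : I × κ, L (Pi.single p.1 (b p.2)) * ∫ z, ℓ p.2 (z p.1) ∂ν := by
      intro ν hR _
      simp only [e]
      rw [integral_finsetSum _ fun p _ => ((hintegrable ν hR p.1 p.2).integrable (by norm_num)).const_mul _]
      simp only [integral_const_mul]
    have hv : ∀ (ν : Measure (T → V)), IsGaussianProcess (fun t (z : T → V) => z t) ν →
        IsProbabilityMeasure ν →
        ∫ z, ((⇑L ∘ fun z : T → V => I.restrict z) ^ 2) z ∂ν =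
          ∑ p : I × κ, ∑ q : I × κ, L (Pi.single p.1 (b p.2)) * L (Pi.single q.1 (b q.2)) *
            ∫ z, ℓ p.2 (z p.1) * ℓ q.2 (z q.1) ∂ν := by
      intro ν hR _
      have e2 : ∀ z : T → V, ((⇑L ∘ fun z : T → V => I.restrict z) ^ 2) z =
          ∑ p : I × κ, ∑ q : I × κ, L (Pi.single p.1 (b p.2)) * L (Pi.single q.1 (b q.2)) *
            (ℓ p.2 (z p.1) * ℓ q.2 (z q.1)) := by
        intro z
        rw [Pi.pow_apply, e, sq, Finset.sum_mul_sum]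
        refine Finset.sum_congr rfl fun p _ => Finset.sum_congr rfl fun q _ => by ring
      simp only [e2]
      have hi : ∀ p q : I × κ, Integrable (fun z : T → V =>
          L (Pi.single p.1 (b p.2)) * L (Pi.single q.1 (b q.2)) *
            (ℓ p.2 (z p.1) * ℓ q.2 (z q.1))) ν := fun p q =>
        ((hintegrable ν hR p.1 p.2).integrable_mul (hintegrable ν hR q.1 q.2)).const_mul _
      rw [integral_finsetSum _ fun p _ => integrable_finsetSum _ fun q _ => hi p q]
      refine Finset.sum_congr rfl fun p _ => ?_
      rw [integral_finsetSum _ fun q _ => hi p q]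
      simp only [integral_const_mul]
    have hml : ∀ (ν : Measure (T → V)), IsGaussianProcess (fun t (z : T → V) => z t) ν →
        MemLp (⇑L ∘ fun z : T → V => I.restrict z) 2 ν := fun ν hR =>
      ((hR.hasGaussianLaw I).map L).memLp_two
    have hE := (hm P hP ‹_›).trans (Eq.trans (by simp only [hmean]) (hm Q hQ ‹_›).symm)
    have hV := (hv P hP ‹_›).trans (Eq.trans (by simp only [hcov]) (hv Q hQ ‹_›).symm)
    rw [hPI.charFunDual_map_eq, hQI.charFunDual_map_eq, variance_eq_sub (hml P hP),
      variance_eq_sub (hml Q hQ), hE, hV]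
  exact IsProjectiveLimit.unique (P := fun I => P.map I.restrict) (fun _ => rfl)
    fun I => (hI I).symm

-- A law is Gaussian if all its linear functionals are. Each functional of finitely many values of
-- `w` agrees almost everywhere with an element of the subspace `G`, whose elements are all
-- Gaussian.
omit [CompleteSpace V] in
theorem isGaussianProcess_of_mem {Ω : Type*} [MeasurableSpace Ω] {P : Measure Ω}
    [IsProbabilityMeasure P] {G : Submodule ℝ (Lp ℂ 2 P)}
    (hG : ∀ Z ∈ G, IsRealCenteredGaussian Z) {ℓ : κ → V →L[ℝ] ℝ} {b : κ → V}
    (hb : ∀ v, ∑ k, ℓ k v • b k = v) {w : T → Ω → V} (hw : ∀ t, AEMeasurable (w t) P)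
    (h : ∀ t k, ∃ Z ∈ G, Z =ᵐ[P] fun ω => (ℓ k (w t ω) : ℂ)) : IsGaussianProcess w P := by
  classical
  refine ⟨fun I => ⟨⟨fun L => ?_⟩⟩⟩
  choose Z hZG hZ using h
  have hm : AEMeasurable (fun ω => I.restrict fun t => w t ω) P :=
    aemeasurable_pi_lambda _ fun t => hw t
  have h1 : HasGaussianLaw (fun ω => L (I.restrict fun t => w t ω)) P := by
    have h2 := (hG _ (G.sum_mem (t := Finset.univ) fun (p : I × κ) _ =>
      G.smul_mem (L (Pi.single p.1 (b p.2))) (hZG p.1 p.2))).hasGaussianLaw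
    refine h2.congr ?_
    filter_upwards [coeFn_sum_smul (X := fun p : I × κ => Z p.1 p.2)
      (x := fun p ω => ℓ p.2 (w p.1 ω)) (fun p => hZ p.1 p.2)
      (fun p => L (Pi.single p.1 (b p.2))) Finset.univ] with ω hω
    rw [hω, Complex.ofReal_re, strongDual_pi_apply_eq_sum hb L]
    rfl
  have h3 := h1.map_eq_gaussianReal
  have h4 : Measurable L := by fun_prop
  rw [AEMeasurable.map_map_of_aemeasurable h4.aemeasurable hm, integral_map hm (by fun_prop),
    variance_map (by fun_prop) hm]
  exact h3

end GaussianFields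

/-! ### Coordinates and real variables in complex `L²` -/

section CoordinateFunctional

/-- The `i`-th coordinate as a continuous linear functional. -/
noncomputable def coordCLM {m : ℕ} (i : Fin m) : EuclideanSpace ℝ (Fin m) →L[ℝ] ℝ :=
  EuclideanSpace.proj i

theorem coordCLM_apply {m : ℕ} (i : Fin m) (v : EuclideanSpace ℝ (Fin m)) : coordCLM i v = v i :=
  rfl

theorem sum_coordCLM_smul_single {m : ℕ} (v : EuclideanSpace ℝ (Fin m)) :
    ∑ k, coordCLM k v • (EuclideanSpace.single k (1 : ℝ) : EuclideanSpace ℝ (Fin m)) = v := by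
  ext i
  simp [coordCLM_apply, Pi.single_apply]

end CoordinateFunctional

section RealVariables

variable {Ω : Type*} [MeasurableSpace Ω] {P : Measure Ω}

/-- A real square integrable variable as an element of the complex `L²` space. -/
noncomputable def realLp {u : Ω → ℝ} (hu : MemLp u 2 P) : Lp ℂ 2 P :=
  (MemLp.ofReal (K := ℂ) hu).toLp _

theorem coeFn_realLp {u : Ω → ℝ} (hu : MemLp u 2 P) : realLp hu =ᵐ[P] fun ω => (u ω : ℂ) :=
  MemLp.coeFn_toLp _

theorem inner_realLp {u v : Ω → ℝ} (hu : MemLp u 2 P) (hv : MemLp v 2 P) :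
    inner ℂ (realLp hv) (realLp hu) = ((∫ ω, u ω * v ω ∂P : ℝ) : ℂ) := by
  rw [← integral_complex_ofReal, L2.inner_def]
  refine integral_congr_ae ?_
  filter_upwards [coeFn_realLp hu, coeFn_realLp hv] with ω h1 h2
  rw [h1, h2]
  simp

end RealVariables

/-! ### Spectral densities of real fields -/

section Fields

variable {d m : ℕ}

theorem IsSpectralDensity.covariance {P : Measure ((Fin d → ℤ) → EuclideanSpace ℝ (Fin m))}
    {Φ : (Fin d → ℝ) → Matrix (Fin m) (Fin m) ℂ} (h : IsSpectralDensity P Φ) (i j : Fin m)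
    (s t : Fin d → ℤ) : ((∫ z, z t i * z s j ∂P : ℝ) : ℂ) =
      ∫ θ, Φ θ i j * torusChar (t - s) θ ∂(torusMeasure d) := by
  have h1 := h.2 (t - s) s i j
  rw [sub_add_cancel] at h1
  exact h1

theorem IsSpectralDensity.memLp_top {P : Measure ((Fin d → ℤ) → EuclideanSpace ℝ (Fin m))}
    {Φ : (Fin d → ℝ) → Matrix (Fin m) (Fin m) ℂ} (h : IsSpectralDensity P Φ)
    (hb : IsBoundedCoercive Φ) (i j : Fin m) : MemLp (fun θ => Φ θ i j) ⊤ (torusMeasure d) :=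
  memLp_top_of_continuousOn_posDefPairs (fun i j => (h.1 i j).1) (fun i j => (h.1 i j).1) hb hb
    continuousOn_fst i j

theorem IsGaussianField.memLp_coord {P : Measure ((Fin d → ℤ) → EuclideanSpace ℝ (Fin m))}
    (h : IsGaussianField P) (t : Fin d → ℤ) (i : Fin m) : MemLp (fun z => z t i) 2 P :=
  ((IsGaussianProcess.hasGaussianLaw_eval h t).map_fun (coordCLM i)).memLp_two

/-- Real fields have conjugate symmetric spectral densities. -/
theorem IsSpectralDensity.reflect {P : Measure ((Fin d → ℤ) → EuclideanSpace ℝ (Fin m))}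
    {Φ : (Fin d → ℝ) → Matrix (Fin m) (Fin m) ℂ} (h : IsSpectralDensity P Φ)
    (hb : IsBoundedCoercive Φ) :
    ∀ᵐ θ ∂(torusMeasure d), Φ (fun k => 2 * Real.pi - θ k) = (Φ θ).map (starRingEnd ℂ) := by
  have key : ∀ i j, ∀ᵐ θ ∂(torusMeasure d),
      Φ (fun k => 2 * Real.pi - θ k) i j = starRingEnd ℂ (Φ θ i j) := by
    intro i j
    have h2 : MemLp (fun θ => Φ θ i j) 2 (torusMeasure d) := (h.memLp_top hb i j).mono_exponent le_top
    have h3 : MemLp (fun θ => Φ (fun k => 2 * Real.pi - θ k) i j) 2 (torusMeasure d) :=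
      h2.comp_measurePreserving measurePreserving_reflect
    have h4 : MemLp (fun θ => starRingEnd ℂ (Φ θ i j)) 2 (torusMeasure d) := h2.star
    have hprod : ∀ {f : (Fin d → ℝ) → ℂ}, MemLp f 2 (torusMeasure d) → ∀ t,
        Integrable (fun θ => f θ * torusChar t θ) (torusMeasure d) := fun hf t =>
      (MemLp.mul' (p := 2) (q := ⊤) (r := 2) (memLp_torusChar t ⊤) hf).integrable (by norm_num)
    -- Reflecting `Φ` moves its coefficient at `-t` to `t`; conjugating `Φ` does the same and
    -- conjugates the value. That value is a real covariance, so the two functions have equal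
    -- Fourier coefficients.
    have h5 := ae_eq_zero_of_integral_torusChar (h3.sub h4) fun t => by
      have e1 : ∫ θ, Φ (fun k => 2 * Real.pi - θ k) i j * torusChar t θ ∂(torusMeasure d) =
          ∫ θ, Φ θ i j * torusChar (-t) θ ∂(torusMeasure d) := by
        rw [← measurePreserving_reflect.integral_comp measurableEmbedding_reflect]
        refine integral_congr_ae (Filter.Eventually.of_forall fun θ => ?_)
        simp only [torusChar_reflect, torusChar_neg, sub_sub_cancel]
      have e2 : ∫ θ, starRingEnd ℂ (Φ θ i j) * torusChar t θ ∂(torusMeasure d) =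
          starRingEnd ℂ (∫ θ, Φ θ i j * torusChar (-t) θ ∂(torusMeasure d)) := by
        rw [← integral_conj]
        refine integral_congr_ae (Filter.Eventually.of_forall fun θ => ?_)
        simp only [map_mul, torusChar_neg, Complex.conj_conj]
      have e3 := h.covariance i j t 0
      rw [zero_sub] at e3
      simp only [Pi.sub_apply, sub_mul]
      rw [integral_sub (hprod h3 t) (hprod h4 t), e1, e2, ← e3, Complex.conj_ofReal, sub_self]
    filter_upwards [h5] with θ hθ
    exact sub_eq_zero.1 hθ
  have : ∀ᵐ θ ∂(torusMeasure d), ∀ i j,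
      Φ (fun k => 2 * Real.pi - θ k) i j = starRingEnd ℂ (Φ θ i j) :=
    ae_all_iff.2 fun i => ae_all_iff.2 fun j => key i j
  filter_upwards [this] with θ hθ
  ext i j
  exact hθ i j

end Fields

/-! ### Filtered fields: covariance, reality and Gaussianity -/

section StationaryFilters

variable {d m : ℕ} {H : Type*} [NormedAddCommGroup H] [InnerProductSpace ℂ H] [CompleteSpace H]

/-- The modulated transfer function `R e^{i⟨θ,t⟩}` is bounded. -/
theorem memLp_top_mul_torusChar {R : Fin m → (Fin d → ℝ) → ℂ}
    (hR : ∀ i, MemLp (R i) ⊤ (torusMeasure d)) (t : Fin d → ℤ) (i : Fin m) :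
    MemLp (fun θ => R i θ * torusChar t θ) ⊤ (torusMeasure d) :=
  MemLp.mul' (memLp_torusChar t ⊤) (hR i)

/-- The output at time `t` of the linear filter with transfer function `R`. -/
noncomputable def filteredField (J : Fin m → Lp ℂ 2 (torusMeasure d) →L[ℂ] H)
    {R : Fin m → (Fin d → ℝ) → ℂ} (hR : ∀ i, MemLp (R i) ⊤ (torusMeasure d)) (t : Fin d → ℤ) : H :=
  filterOutput J (memLp_top_mul_torusChar hR t)

/-- The modulations combine to the character at `t - s`: filtered fields are again jointly
stationary, with cross density `R Φ R'*`. -/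
theorem inner_filteredField {Y : Fin m → (Fin d → ℤ) → H}
    {J : Fin m → Lp ℂ 2 (torusMeasure d) →L[ℂ] H} (hJ : ∀ i t, J i (torusCharLp t) = Y i t)
    {Φ : (Fin d → ℝ) → Matrix (Fin m) (Fin m) ℂ}
    (hΦ : ∀ i j, MemLp (fun θ => Φ θ i j) 2 (torusMeasure d))
    (hY : ∀ i j s t, inner ℂ (Y j s) (Y i t) =
      ∫ θ, Φ θ i j * torusChar (t - s) θ ∂(torusMeasure d))
    {R R' : Fin m → (Fin d → ℝ) → ℂ} (hR : ∀ i, MemLp (R i) ⊤ (torusMeasure d))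
    (hR' : ∀ i, MemLp (R' i) ⊤ (torusMeasure d)) (s t : Fin d → ℤ) :
    inner ℂ (filteredField J hR' s) (filteredField J hR t) =
      ∫ θ, (∑ i, ∑ j, R i θ * Φ θ i j * starRingEnd ℂ (R' j θ)) * torusChar (t - s) θ
        ∂(torusMeasure d) := by
  rw [filteredField, filteredField,
    inner_filterOutput hJ hJ hΦ hY (memLp_top_mul_torusChar hR' s) (memLp_top_mul_torusChar hR t)]
  refine integral_congr_ae (Filter.Eventually.of_forall fun θ => ?_)
  simp only [Finset.sum_mul]
  refine Finset.sum_congr rfl fun i _ => Finset.sum_congr rfl fun j _ => ?_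
  rw [sub_eq_add_neg, torusChar_add, torusChar_neg, map_mul]
  ring

-- A row of the identity matrix is the filter that returns a component of the input. Thus both
-- members of the optimal pair are filter outputs and can be treated alike.
omit [CompleteSpace H] in
theorem filteredField_one {Y : Fin m → (Fin d → ℤ) → H}
    {J : Fin m → Lp ℂ 2 (torusMeasure d) →L[ℂ] H} (hJ : ∀ i t, J i (torusCharLp t) = Y i t)
    (i : Fin m)
    (hR : ∀ k, MemLp (fun _ : Fin d → ℝ => (1 : Matrix (Fin m) (Fin m) ℂ) i k) ⊤ (torusMeasure d))
    (t : Fin d → ℤ) : filteredField J hR t = Y i t := by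
  have h : ∀ k, bddLp (memLp_top_mul_torusChar hR t k) =
      ((1 : Matrix (Fin m) (Fin m) ℂ) i k) • torusCharLp t := by
    intro k
    refine Lp.ext ?_
    filter_upwards [coeFn_bddLp (memLp_top_mul_torusChar hR t k), coeFn_torusCharLp t,
      Lp.coeFn_smul ((1 : Matrix (Fin m) (Fin m) ℂ) i k) (torusCharLp t)] with θ h1 h2 h3
    rw [h1, h3, Pi.smul_apply, h2, smul_eq_mul]
  change ∑ k, J k (bddLp (memLp_top_mul_torusChar hR t k)) = _
  refine (Finset.sum_congr rfl fun k _ => congrArg (J k) (h k)).trans ?_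
  rw [Finset.sum_eq_single i (fun k _ hk => by
    rw [Matrix.one_apply_ne hk.symm, zero_smul, map_zero]) (by simp), Matrix.one_apply_eq, one_smul,
    hJ]

variable {Ω : Type*} [MeasurableSpace Ω] {P : Measure Ω}

/-- Conjugate symmetry makes the Fourier coefficients of the transfer function real, so the Fourier
series presents the output as a limit of real combinations of the input variables. Complex
combinations would leave the real Gaussian space. -/
theorem filteredField_mem_gaussianSpace {Y : Fin m → (Fin d → ℤ) → Lp ℂ 2 P}
    {J : Fin m → Lp ℂ 2 (torusMeasure d) →L[ℂ] Lp ℂ 2 P}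
    (hJ : ∀ i t, J i (torusCharLp t) = Y i t)
    {R : Fin m → (Fin d → ℝ) → ℂ} (hR : ∀ i, MemLp (R i) ⊤ (torusMeasure d))
    (hsymm : ∀ i, ∀ᵐ θ ∂(torusMeasure d),
      R i (fun k => 2 * Real.pi - θ k) = starRingEnd ℂ (R i θ)) (t : Fin d → ℤ) :
    filteredField J hR t ∈ gaussianSpace fun p : Fin m × (Fin d → ℤ) => Y p.1 p.2 := by
  rw [filteredField, filterOutput]
  refine Submodule.sum_mem _ fun i _ => ?_
  set f := bddLp (memLp_top_mul_torusChar hR t i) with hf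
  have hreal : ∀ s, starRingEnd ℂ (inner ℂ (torusCharLp s) f) = inner ℂ (torusCharLp s) f := by
    intro s
    have e : inner ℂ (torusCharLp s) f =
        ∫ θ, R i θ * torusChar (t - s) θ ∂(torusMeasure d) := by
      rw [inner_torusCharLp_left]
      refine integral_congr_ae ?_
      filter_upwards [coeFn_bddLp (memLp_top_mul_torusChar hR t i)] with θ h1
      rw [hf, h1, sub_eq_add_neg, torusChar_add]
      ring
    rw [e, ← integral_conj]
    conv_rhs => rw [← measurePreserving_reflect.integral_comp measurableEmbedding_reflect]
    refine integral_congr_ae ?_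
    filter_upwards [hsymm i] with θ h1
    rw [h1, torusChar_reflect, map_mul]
  have hsum : HasSum (fun s => (inner ℂ (torusCharLp s) f).re • Y i s) (J i f) := by
    have h1 := (J i).hasSum ((torusBasis d).hasSum_repr f)
    refine h1.congr_fun fun s => ?_
    rw [map_smul, HilbertBasis.repr_apply_apply, torusBasis_apply, hJ]
    have h2 : ((inner ℂ (torusCharLp s) f).re : ℂ) = inner ℂ (torusCharLp s) f :=
      Complex.conj_eq_iff_re.1 (hreal s)
    conv_rhs => rw [← h2]
    exact (Complex.coe_smul _ _).symm
  refine (Submodule.isClosed_topologicalClosure _).mem_of_tendsto hsum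
    (Filter.Eventually.of_forall fun I => ?_)
  refine Submodule.sum_mem _ fun s _ => Submodule.smul_mem _ _ ?_
  exact Submodule.le_topologicalClosure _ (Submodule.subset_span ⟨(i, s), rfl⟩)

end StationaryFilters

/-! ### Coordinates of pairs and comparison of Gaussian laws -/

section Coordinates

/-- The coordinates of a pair of vectors. -/
noncomputable def pairCoord (m : ℕ) : Fin m ⊕ Fin m →
    (EuclideanSpace ℝ (Fin m) × EuclideanSpace ℝ (Fin m)) →L[ℝ] ℝ :=
  Sum.elim
    (fun i => (coordCLM i) ∘L ContinuousLinearMap.fst ℝ _ _)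
    (fun i => (coordCLM i) ∘L ContinuousLinearMap.snd ℝ _ _)

/-- The basis vectors of the space of pairs. -/
noncomputable def pairVec (m : ℕ) : Fin m ⊕ Fin m →
    EuclideanSpace ℝ (Fin m) × EuclideanSpace ℝ (Fin m) :=
  Sum.elim (fun i => (EuclideanSpace.single i 1, 0)) (fun i => (0, EuclideanSpace.single i 1))

theorem sum_pairCoord_smul_pairVec {m : ℕ}
    (v : EuclideanSpace ℝ (Fin m) × EuclideanSpace ℝ (Fin m)) :
    ∑ k, pairCoord m k v • pairVec m k = v := by
  rw [Fintype.sum_sum_type]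
  have h1 := sum_coordCLM_smul_single v.1
  have h2 := sum_coordCLM_smul_single v.2
  refine Prod.ext ?_ ?_
  · simpa [pairCoord, pairVec, Prod.fst_sum] using h1
  · simpa [pairCoord, pairVec, Prod.snd_sum] using h2

end Coordinates

section MapCoordinates

theorem ProbabilityTheory.IsGaussianProcess.map_coord {T Ω V : Type*} [MeasurableSpace Ω] [MeasurableSpace V]
    [TopologicalSpace V] [AddCommMonoid V] [Module ℝ V] {P : Measure Ω} {w : T → Ω → V}
    (h : IsGaussianProcess w P) (hw : ∀ t, Measurable (w t)) :
    IsGaussianProcess (fun t (z : T → V) => z t) (P.map fun ω t => w t ω) := by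
  refine ⟨fun I => ⟨?_⟩⟩
  have h1 := (h.hasGaussianLaw I).isGaussian_map
  have h2 : Measurable fun z : T → V => I.restrict fun t => z t := by
    fun_prop
  rw [Measure.map_map h2 (measurable_pi_lambda _ hw)]
  exact h1

/-- Gaussian processes with the same means and covariances have the same law. -/
theorem ProbabilityTheory.IsGaussianProcess.map_ext {T Ω Ω' V κ : Type*} [MeasurableSpace Ω]
    [MeasurableSpace Ω'] [Fintype κ] [NormedAddCommGroup V] [NormedSpace ℝ V] [MeasurableSpace V]
    [BorelSpace V] [SecondCountableTopology V] [CompleteSpace V] {P : Measure Ω} {P' : Measure Ω'}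
    {w : T → Ω → V} {w' : T → Ω' → V} (h : IsGaussianProcess w P) (h' : IsGaussianProcess w' P')
    (hw : ∀ t, Measurable (w t)) (hw' : ∀ t, Measurable (w' t))
    {ℓ : κ → V →L[ℝ] ℝ} {b : κ → V} (hb : ∀ v, ∑ k, ℓ k v • b k = v)
    (hmean : ∀ t k, ∫ ω, ℓ k (w t ω) ∂P = ∫ ω, ℓ k (w' t ω) ∂P')
    (hcov : ∀ s t k l, ∫ ω, ℓ k (w s ω) * ℓ l (w t ω) ∂P =
      ∫ ω, ℓ k (w' s ω) * ℓ l (w' t ω) ∂P') :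
    P.map (fun ω t => w t ω) = P'.map (fun ω t => w' t ω) := by
  have hℓ : ∀ k t, Measurable fun z : T → V => ℓ k (z t) := fun k t =>
    (ℓ k).continuous.measurable.comp (measurable_pi_apply t)
  have hℓ2 : ∀ k l s t, Measurable fun z : T → V => ℓ k (z s) * ℓ l (z t) := fun k l s t =>
    (hℓ k s).mul (hℓ l t)
  have hm := (measurable_pi_lambda _ hw).aemeasurable (μ := P)
  have hm' := (measurable_pi_lambda _ hw').aemeasurable (μ := P')
  refine IsGaussianProcess.measure_ext (h.map_coord hw) (h'.map_coord hw') hb (fun t k => ?_)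
    fun s t k l => ?_
  · rw [integral_map hm (hℓ k t).aestronglyMeasurable,
      integral_map hm' (hℓ k t).aestronglyMeasurable]
    exact hmean t k
  · rw [integral_map hm (hℓ2 k l s t).aestronglyMeasurable,
      integral_map hm' (hℓ2 k l s t).aestronglyMeasurable]
    exact hcov s t k l

end MapCoordinates

/-! ### The common optimal value -/

section OptimalValue

variable {d m : ℕ} {Φx Φy : (Fin d → ℝ) → Matrix (Fin m) (Fin m) ℂ}

/-- The integral of the trace of the Hellinger integrand. -/
noncomputable def hellingerValue (Φx Φy : (Fin d → ℝ) → Matrix (Fin m) (Fin m) ℂ) : ℝ :=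
  ∫ θ, (hellingerIntegrand Φx Φy θ).trace.re ∂(torusMeasure d)

theorem re_trace_hellingerIntegrand (θ : Fin d → ℝ) :
    (hellingerIntegrand Φx Φy θ).trace.re = (Φx θ).trace.re + (Φy θ).trace.re -
      2 * (Matrix.fidelity (Φx θ) (Φy θ)).trace.re := by
  change (Φx θ + Φy θ - (2 : ℂ) • Matrix.fidelity (Φx θ) (Φy θ)).trace.re = _
  rw [Matrix.trace_sub, Matrix.trace_add, Matrix.trace_smul]
  simp

theorem integrable_trace {F : (Fin d → ℝ) → Matrix (Fin m) (Fin m) ℂ}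
    (hF : ∀ i j, MemLp (fun θ => F θ i j) ⊤ (torusMeasure d)) :
    Integrable (fun θ => (F θ).trace) (torusMeasure d) :=
  integrable_finsetSum _ fun i _ => (hF i i).integrable le_top

variable (hmx : ∀ i j, MemLp (fun θ => Φx θ i j) ⊤ (torusMeasure d))
  (hmy : ∀ i j, MemLp (fun θ => Φy θ i j) ⊤ (torusMeasure d))
  (hbx : IsBoundedCoercive Φx) (hby : IsBoundedCoercive Φy)

include hmx hmy hbx hby

theorem memLp_top_fidelity (i j : Fin m) :
    MemLp (fun θ => Matrix.fidelity (Φx θ) (Φy θ) i j) ⊤ (torusMeasure d) :=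
  memLp_top_of_continuousOn_posDefPairs (fun i j => (hmx i j).1) (fun i j => (hmy i j).1) hbx hby
    Matrix.continuousOn_fidelity i j

theorem memLp_top_hellingerIntegrand (i j : Fin m) :
    MemLp (fun θ => hellingerIntegrand Φx Φy θ i j) ⊤ (torusMeasure d) :=
  ((hmx i j).add (hmy i j)).sub ((memLp_top_fidelity hmx hmy hbx hby i j).const_mul 2)

theorem hellingerValue_eq : hellingerValue Φx Φy =
    (∫ θ, (Φx θ).trace ∂(torusMeasure d)).re + (∫ θ, (Φy θ).trace ∂(torusMeasure d)).re -
      2 * (∫ θ, (Matrix.fidelity (Φx θ) (Φy θ)).trace ∂(torusMeasure d)).re := by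
  have hf := integrable_trace (memLp_top_fidelity hmx hmy hbx hby)
  have hre : ∀ {f : (Fin d → ℝ) → ℂ}, Integrable f (torusMeasure d) →
      (∫ θ, f θ ∂(torusMeasure d)).re = ∫ θ, (f θ).re ∂(torusMeasure d) := fun hf =>
    (integral_re hf).symm
  have hx : Integrable (fun θ => (Φx θ).trace.re) (torusMeasure d) := (integrable_trace hmx).re
  have hy : Integrable (fun θ => (Φy θ).trace.re) (torusMeasure d) := (integrable_trace hmy).re
  have hxy : Integrable (fun θ => (Φx θ).trace.re + (Φy θ).trace.re) (torusMeasure d) := hx.add hy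
  have hf' : Integrable (fun θ => 2 * (Matrix.fidelity (Φx θ) (Φy θ)).trace.re) (torusMeasure d) :=
    hf.re.const_mul 2
  rw [hre (integrable_trace hmx), hre (integrable_trace hmy), hre hf, ← integral_const_mul,
    ← integral_add hx hy, ← integral_sub hxy hf']
  exact integral_congr_ae (Filter.Eventually.of_forall re_trace_hellingerIntegrand)

/-- The integrand is almost everywhere Hermitian, so its trace is real and passing to real parts
loses nothing. -/
theorem ofReal_hellingerValue : (hellingerValue Φx Φy : ℂ) =
    (matrixTorusIntegral (hellingerIntegrand Φx Φy)).trace := by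
  have h1 : (matrixTorusIntegral (hellingerIntegrand Φx Φy)).trace =
      ∫ θ, (hellingerIntegrand Φx Φy θ).trace ∂(torusMeasure d) := by
    simp only [Matrix.trace, Matrix.diag_apply]
    rw [integral_finsetSum _ fun i _ =>
      (memLp_top_hellingerIntegrand hmx hmy hbx hby i i).integrable le_top]
    rfl
  rw [h1, hellingerValue, ← integral_complex_ofReal]
  refine integral_congr_ae ?_
  filter_upwards [hbx.posDef, hby.posDef] with θ hx hy
  refine Complex.conj_eq_iff_re.1 ?_
  change star (Φx θ + Φy θ - (2 : ℂ) • Matrix.fidelity (Φx θ) (Φy θ)).trace =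
    (Φx θ + Φy θ - (2 : ℂ) • Matrix.fidelity (Φx θ) (Φy θ)).trace
  rw [← Matrix.trace_conjTranspose, Matrix.conjTranspose_sub, Matrix.conjTranspose_add,
    Matrix.conjTranspose_smul, hx.isHermitian.eq, hy.isHermitian.eq, (hx.fidelity hy).isHermitian.eq]
  simp

end OptimalValue

/-! ### Optimality over Gaussian couplings -/

section Couplings

variable {d m : ℕ}

theorem integral_norm_sub_sq {Ω : Type*} [MeasurableSpace Ω] {P : Measure Ω}
    {x y : Ω → EuclideanSpace ℝ (Fin m)} (hx : ∀ i, MemLp (fun ω => x ω i) 2 P)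
    (hy : ∀ i, MemLp (fun ω => y ω i) 2 P) :
    ∫ ω, ‖x ω - y ω‖ ^ 2 ∂P = ∑ i, ∫ ω, x ω i * x ω i ∂P + ∑ i, ∫ ω, y ω i * y ω i ∂P -
      2 * ∑ i, ∫ ω, x ω i * y ω i ∂P := by
  have h : ∀ ω, ‖x ω - y ω‖ ^ 2 =
      ∑ i, (x ω i * x ω i + y ω i * y ω i - 2 * (x ω i * y ω i)) := by
    intro ω
    rw [EuclideanSpace.real_norm_sq_eq]
    refine Finset.sum_congr rfl fun i _ => ?_
    simp only [PiLp.sub_apply]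
    ring
  have h1 : ∀ i, Integrable (fun ω => x ω i * x ω i) P := fun i => (hx i).integrable_mul (hx i)
  have h2 : ∀ i, Integrable (fun ω => y ω i * y ω i) P := fun i => (hy i).integrable_mul (hy i)
  have h3 : ∀ i, Integrable (fun ω => x ω i * y ω i) P := fun i => (hx i).integrable_mul (hy i)
  have h4 : ∀ i, Integrable (fun ω => x ω i * x ω i + y ω i * y ω i - 2 * (x ω i * y ω i)) P :=
    fun i => ((h1 i).add (h2 i)).sub ((h3 i).const_mul 2)
  have h5 : ∀ i, Integrable (fun ω => x ω i * x ω i + y ω i * y ω i) P :=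
    fun i => (h1 i).add (h2 i)
  simp only [h]
  rw [integral_finsetSum _ fun i _ => h4 i, Finset.mul_sum,
    ← Finset.sum_add_distrib, ← Finset.sum_sub_distrib]
  refine Finset.sum_congr rfl fun i _ => ?_
  rw [integral_sub (h5 i) ((h3 i).const_mul 2), integral_add (h1 i) (h2 i),
    integral_const_mul]

theorem IsSpectralDensity.sum_variance {P : Measure ((Fin d → ℤ) → EuclideanSpace ℝ (Fin m))}
    {Φ : (Fin d → ℝ) → Matrix (Fin m) (Fin m) ℂ} (h : IsSpectralDensity P Φ) (t : Fin d → ℤ) :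
    ∑ i, ∫ z, z t i * z t i ∂P = (∫ θ, (Φ θ).trace ∂(torusMeasure d)).re := by
  have h1 : (∫ θ, (Φ θ).trace ∂(torusMeasure d)) = ((∑ i, ∫ z, z t i * z t i ∂P : ℝ) : ℂ) := by
    simp only [Matrix.trace, Matrix.diag_apply]
    rw [integral_finsetSum _ fun i _ => h.1 i i, Complex.ofReal_sum]
    refine Finset.sum_congr rfl fun i _ => ?_
    rw [h.covariance i i t t]
    simp [torusChar_zero]
  rw [h1, Complex.ofReal_re]

variable {px py : Measure ((Fin d → ℤ) → EuclideanSpace ℝ (Fin m))}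
  {Φx Φy : (Fin d → ℝ) → Matrix (Fin m) (Fin m) ℂ}

/-- Apply `two_mul_re_sum_inner_le` with weight `K^{-1/2}` on `x` and `K^{1/2}` on `y`: both
weighted traces integrate to `∫ tr F`, while the marginals fix the variances. -/
theorem hellingerValue_le_transportCost (hΦx : IsSpectralDensity px Φx)
    (hΦy : IsSpectralDensity py Φy) (hbx : IsBoundedCoercive Φx) (hby : IsBoundedCoercive Φy)
    {γ : Measure ((Fin d → ℤ) → EuclideanSpace ℝ (Fin m) × EuclideanSpace ℝ (Fin m))}
    (hγ : γ ∈ gaussianCouplings px py) (t : Fin d → ℤ) :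
    hellingerValue Φx Φy ≤ ∫ z, ‖(z t).1 - (z t).2‖ ^ 2 ∂γ := by
  obtain ⟨hG, hs, hfst, hsnd⟩ := hγ
  have := hG.isProbabilityMeasure
  have hx : ∀ i t, MemLp (fun z : (Fin d → ℤ) → EuclideanSpace ℝ (Fin m) × EuclideanSpace ℝ (Fin m) =>
      (z t).1 i) 2 γ := fun i t =>
    ((IsGaussianProcess.hasGaussianLaw_eval hG t).map_fun
      (coordCLM i ∘L ContinuousLinearMap.fst ℝ _ _)).memLp_two
  have hy : ∀ i t, MemLp (fun z : (Fin d → ℤ) → EuclideanSpace ℝ (Fin m) × EuclideanSpace ℝ (Fin m) =>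
      (z t).2 i) 2 γ := fun i t =>
    ((IsGaussianProcess.hasGaussianLaw_eval hG t).map_fun
      (coordCLM i ∘L ContinuousLinearMap.snd ℝ _ _)).memLp_two
  have mx : ∀ i j s t, ∫ z, (z t).1 i * (z s).1 j ∂γ = ∫ z, z t i * z s j ∂px := by
    intro i j s t
    rw [← hfst, integral_map (measurable_pi_lambda _ fun t => by fun_prop).aemeasurable (by fun_prop)]
  have my : ∀ i j s t, ∫ z, (z t).2 i * (z s).2 j ∂γ = ∫ z, z t i * z s j ∂py := by
    intro i j s t
    rw [← hsnd, integral_map (measurable_pi_lambda _ fun t => by fun_prop).aemeasurable (by fun_prop)]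
  have mxy : ∀ i j s t r, ∫ z, (z (t + r)).1 i * (z (s + r)).2 j ∂γ =
      ∫ z, (z t).1 i * (z s).2 j ∂γ := by
    intro i j s t r
    conv_rhs => rw [← hs r]
    rw [integral_map (measurable_pi_lambda _ fun t => by fun_prop).aemeasurable (by fun_prop)]
  have hmx := hΦx.memLp_top hbx
  have hmy := hΦy.memLp_top hby
  have hpos : ∀ᵐ θ ∂(torusMeasure d), (Φx θ).PosDef ∧ (Φy θ).PosDef := hbx.posDef.and hby.posDef
  have hS := memLp_top_of_continuousOn_posDefPairs (fun i j => (hmx i j).1) (fun i j => (hmy i j).1)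
    hbx hby Matrix.continuousOn_sqrtTransportMap
  have hT := memLp_top_of_continuousOn_posDefPairs (fun i j => (hmx i j).1) (fun i j => (hmy i j).1)
    hbx hby Matrix.continuousOn_inv_sqrtTransportMap
  have key := two_mul_re_sum_inner_le (X := fun i t => realLp (hx i t))
    (Y := fun i t => realLp (hy i t)) hmx hmy
    (fun i j s t => by rw [inner_realLp, mx, hΦx.covariance])
    (fun i j s t => by rw [inner_realLp, my, hΦy.covariance])
    (fun i j s t r => by rw [inner_realLp, inner_realLp, mxy]) hS hT
    (by
      filter_upwards [hpos] with θ hθ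
      have h1 := hθ.1.sqrtTransportMap hθ.2
      rw [h1.isHermitian.eq, Matrix.mul_nonsing_inv _ h1.isUnit_det'])
  have e1 : (∫ θ, ((Matrix.sqrtTransportMap (Φx θ) (Φy θ))⁻¹ * Φx θ *
      ((Matrix.sqrtTransportMap (Φx θ) (Φy θ))⁻¹).conjTranspose).trace ∂(torusMeasure d)) =
      ∫ θ, (Matrix.fidelity (Φx θ) (Φy θ)).trace ∂(torusMeasure d) := by
    refine integral_congr_ae ?_
    filter_upwards [hpos] with θ hθ
    rw [(hθ.1.sqrtTransportMap hθ.2).inv.isHermitian.eq,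
      Matrix.trace_inv_sqrtTransportMap_mul_mul hθ.1 hθ.2]
  have e2 : (∫ θ, (Matrix.sqrtTransportMap (Φx θ) (Φy θ) * Φy θ *
      (Matrix.sqrtTransportMap (Φx θ) (Φy θ)).conjTranspose).trace ∂(torusMeasure d)) =
      ∫ θ, (Matrix.fidelity (Φx θ) (Φy θ)).trace ∂(torusMeasure d) := by
    refine integral_congr_ae ?_
    filter_upwards [hpos] with θ hθ
    rw [(hθ.1.sqrtTransportMap hθ.2).isHermitian.eq,
      Matrix.trace_sqrtTransportMap_mul_mul hθ.1 hθ.2]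
  rw [e1, e2] at key
  -- The bound concerns site `0`; joint stationarity moves it to `t`.
  have e3 : (∑ i, inner ℂ (realLp (hy i 0)) (realLp (hx i 0))).re =
      ∑ i, ∫ z, (z t).1 i * (z t).2 i ∂γ := by
    rw [Complex.re_sum]
    refine Finset.sum_congr rfl fun i _ => ?_
    rw [inner_realLp, Complex.ofReal_re, ← mxy i i 0 0 t, zero_add]
  rw [e3] at key
  rw [integral_norm_sub_sq (fun i => hx i t) (fun i => hy i t), hellingerValue_eq hmx hmy hbx hby]
  simp only [mx, my]
  rw [hΦx.sum_variance, hΦy.sum_variance]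
  linarith

theorem IsZeroMeanField.integral_coord {P : Measure ((Fin d → ℤ) → EuclideanSpace ℝ (Fin m))}
    (h : IsZeroMeanField P) (hG : IsGaussianField P) (t : Fin d → ℤ) (i : Fin m) :
    ∫ z, z t i ∂P = 0 := by
  have h1 := (coordCLM i).integral_comp_comm
    (IsGaussianProcess.hasGaussianLaw_eval hG t).integrable
  rw [h t, map_zero] at h1
  exact h1

/-- The optimal process: the second component is the coordinate process, the first component is
the output of the filter with the optimal transfer function. -/
theorem exists_optimal_process (hpy : IsGaussianField py)
    (hzy : IsZeroMeanField py) (hΦx : IsSpectralDensity px Φx)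
    (hΦy : IsSpectralDensity py Φy) (hbx : IsBoundedCoercive Φx) (hby : IsBoundedCoercive Φy) :
    ∃ w : (Fin d → ℤ) → ((Fin d → ℤ) → EuclideanSpace ℝ (Fin m)) →
        EuclideanSpace ℝ (Fin m) × EuclideanSpace ℝ (Fin m),
      (∀ t, Measurable (w t)) ∧ (∀ t z, (w t z).2 = z t) ∧ IsGaussianProcess w py ∧
      (∀ q t, ∫ z, pairCoord m q (w t z) ∂py = 0) ∧
      (∀ q q' s t r, ∫ z, pairCoord m q (w (t + r) z) * pairCoord m q' (w (s + r) z) ∂py =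
        ∫ z, pairCoord m q (w t z) * pairCoord m q' (w s z) ∂py) ∧
      (∀ i j s t, ∫ z, (w t z).1 i * (w s z).1 j ∂py = ∫ z, z t i * z s j ∂px) ∧
      ∀ i t, ((∫ z, (w t z).1 i * (w t z).2 i ∂py : ℝ) : ℂ) =
        ∫ θ, (Matrix.transportMap (Φx θ) (Φy θ) * Φy θ) i i ∂(torusMeasure d) := by
  have := hpy.isProbabilityMeasure
  have hmx := hΦx.memLp_top hbx
  have hmy := hΦy.memLp_top hby
  have hmy2 : ∀ i j, MemLp (fun θ => Φy θ i j) 2 (torusMeasure d) := fun i j =>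
    (hmy i j).mono_exponent le_top
  have hpos : ∀ᵐ θ ∂(torusMeasure d), (Φx θ).PosDef ∧ (Φy θ).PosDef := hbx.posDef.and hby.posDef
  set Y : Fin m → (Fin d → ℤ) → Lp ℂ 2 py := fun i t => realLp (hpy.memLp_coord t i) with hYdef
  have hY : ∀ i j s t, inner ℂ (Y j s) (Y i t) =
      ∫ θ, Φy θ i j * torusChar (t - s) θ ∂(torusMeasure d) := fun i j s t => by
    rw [hYdef, inner_realLp, hΦy.covariance]
  choose J hJ using fun i => exists_spectralMap (hmy i i) (hY i i)
  set G := gaussianSpace fun p : Fin m × (Fin d → ℤ) => Y p.1 p.2 with hGdef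
  have hG : ∀ Z ∈ G, IsRealCenteredGaussian Z := by
    intro Z hZ
    refine isRealCenteredGaussian_of_mem_gaussianSpace (x := fun p z => z p.2 p.1)
      (fun p => coeFn_realLp (hpy.memLp_coord p.2 p.1)) ?_
      (fun p => hzy.integral_coord hpy p.2 p.1) hZ
    refine IsGaussianProcess.of_isGaussianProcess hpy fun p => ⟨{p.2},
      coordCLM p.1 ∘L ContinuousLinearMap.proj ⟨p.2, by simp⟩, fun z => rfl⟩
  -- The pair is the output of the stacked filter with blocks `K` and `1`, driven by `y`.
  set R : Fin m ⊕ Fin m → Fin m → (Fin d → ℝ) → ℂ := Sum.elim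
    (fun i k θ => Matrix.transportMap (Φx θ) (Φy θ) i k)
    (fun i k _ => (1 : Matrix (Fin m) (Fin m) ℂ) i k) with hRdef
  have hR : ∀ q k, MemLp (R q k) ⊤ (torusMeasure d) := by
    rintro (i | i) k
    · exact memLp_top_of_continuousOn_posDefPairs (fun i j => (hmx i j).1)
        (fun i j => (hmy i j).1) hbx hby Matrix.continuousOn_transportMap i k
    · exact memLp_const _
  have hRsymm : ∀ q k, ∀ᵐ θ ∂(torusMeasure d),
      R q k (fun k => 2 * Real.pi - θ k) = starRingEnd ℂ (R q k θ) := by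
    rintro (i | i) k
    · filter_upwards [hpos, hΦx.reflect hbx, hΦy.reflect hby] with θ hθ h1 h2
      simp only [hRdef, Sum.elim_inl]
      rw [h1, h2, Matrix.transportMap_map_conj hθ.1 hθ.2]
      rfl
    · refine Filter.Eventually.of_forall fun θ => ?_
      simp only [hRdef, Sum.elim_inr, Matrix.one_apply]
      split_ifs <;> simp
  set Z : Fin m ⊕ Fin m → (Fin d → ℤ) → Lp ℂ 2 py := fun q t => filteredField J (hR q) t with hZdef
  have hZG : ∀ q t, Z q t ∈ G := fun q t => filteredField_mem_gaussianSpace hJ (hR q) (hRsymm q) t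
  have hZY : ∀ i t, Z (Sum.inr i) t = Y i t := fun i t =>
    filteredField_one hJ i (hR (Sum.inr i)) t
  have hZim : ∀ q t, ∀ᵐ z ∂py, (Z q t z).im = 0 := fun q t => (hG _ (hZG q t)).1
  -- The second component is the coordinate process itself rather than an `L²` representative, so
  -- the second marginal will be `py` by definition.
  set w : (Fin d → ℤ) → ((Fin d → ℤ) → EuclideanSpace ℝ (Fin m)) →
      EuclideanSpace ℝ (Fin m) × EuclideanSpace ℝ (Fin m) := fun t z =>
    (WithLp.toLp 2 fun i => (Z (Sum.inl i) t z).re, z t) with hwdef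
  have hw : ∀ t, Measurable (w t) := by
    intro t
    refine Measurable.prodMk ?_ (measurable_pi_apply t)
    refine (WithLp.measurable_toLp 2 _).comp (measurable_pi_lambda _ fun i => ?_)
    exact Complex.measurable_re.comp (Lp.stronglyMeasurable _).measurable
  have hwZ : ∀ t q, Z q t =ᵐ[py] fun z => (pairCoord m q (w t z) : ℂ) := by
    rintro t (i | i)
    · filter_upwards [hZim (Sum.inl i) t] with z hz
      exact Complex.ext (by simp [pairCoord, hwdef, coordCLM_apply]) (by simpa using hz)
    · rw [hZY]
      exact coeFn_realLp (hpy.memLp_coord t i)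
  have hwcov : ∀ q q' s t, ((∫ z, pairCoord m q (w t z) * pairCoord m q' (w s z) ∂py : ℝ) : ℂ) =
      ∫ θ, (∑ i, ∑ j, R q i θ * Φy θ i j * starRingEnd ℂ (R q' j θ)) * torusChar (t - s) θ
        ∂(torusMeasure d) := by
    intro q q' s t
    rw [← inner_filteredField hJ hmy2 hY (hR q) (hR q') s t,
      ← ofReal_integral_re_mul_re (hZim q t) (hZim q' s)]
    congr 1
    refine integral_congr_ae ?_
    filter_upwards [hwZ t q, hwZ s q'] with z h1 h2
    rw [h1, h2, Complex.ofReal_re, Complex.ofReal_re]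
  have hwmean : ∀ q t, ∫ z, pairCoord m q (w t z) ∂py = 0 := by
    intro q t
    rw [← (hG _ (hZG q t)).integral_re]
    refine integral_congr_ae ?_
    filter_upwards [hwZ t q] with z h1
    rw [h1, Complex.ofReal_re]
  have hwgauss : IsGaussianProcess w py := isGaussianProcess_of_mem hG sum_pairCoord_smul_pairVec
    (fun t => (hw t).aemeasurable) fun t q => ⟨Z q t, hZG q t, hwZ t q⟩
  -- The first component has density `K Φy K* = K Φy K = Φx`.
  have hxx : ∀ i j s t, ∫ z, (w t z).1 i * (w s z).1 j ∂py = ∫ z, z t i * z s j ∂px := by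
    intro i j s t
    refine Complex.ofReal_injective ?_
    rw [hΦx.covariance]
    refine (hwcov (Sum.inl i) (Sum.inl j) s t).trans (integral_congr_ae ?_)
    filter_upwards [hpos] with θ hθ
    congr 1
    have h1 := Matrix.transportMap_mul_mul_transportMap hθ.1 hθ.2
    have h2 := (hθ.1.transportMap hθ.2).isHermitian
    conv_rhs => rw [← h1, Matrix.mul_apply]
    simp only [Matrix.mul_apply, Finset.sum_mul, hRdef, Sum.elim_inl]
    rw [Finset.sum_comm]
    refine Finset.sum_congr rfl fun l _ => Finset.sum_congr rfl fun k _ => ?_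
    rw [← h2.apply l j]
    rfl
  have hxy : ∀ i t, ((∫ z, (w t z).1 i * (w t z).2 i ∂py : ℝ) : ℂ) =
      ∫ θ, (Matrix.transportMap (Φx θ) (Φy θ) * Φy θ) i i ∂(torusMeasure d) := by
    intro i t
    refine (hwcov (Sum.inl i) (Sum.inr i) t t).trans
      (integral_congr_ae (Filter.Eventually.of_forall fun θ => ?_))
    simp only [hRdef, Sum.elim_inl, Sum.elim_inr, sub_self, torusChar_zero, mul_one,
      Matrix.mul_apply, Matrix.one_apply]
    refine Finset.sum_congr rfl fun k _ => ?_
    simp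
  refine ⟨w, hw, fun t z => rfl, hwgauss, hwmean, fun q q' s t r => ?_, hxx, hxy⟩
  refine Complex.ofReal_injective ?_
  refine (hwcov q q' (s + r) (t + r)).trans (Eq.trans ?_ (hwcov q q' s t).symm)
  rw [add_sub_add_right_eq_sub]

/-- The law of the optimal process. Stationarity and the first marginal are equalities of Gaussian
laws with the same first two moments; in the cost, the cross term is `∫ tr (K Φy) = ∫ tr F`. -/
theorem exists_optimal_coupling (hpx : IsGaussianField px) (hpy : IsGaussianField py)
    (hzx : IsZeroMeanField px) (hzy : IsZeroMeanField py) (hΦx : IsSpectralDensity px Φx)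
    (hΦy : IsSpectralDensity py Φy) (hbx : IsBoundedCoercive Φx) (hby : IsBoundedCoercive Φy) :
    ∃ γ ∈ gaussianCouplings px py, ∀ t,
      ∫ z, ‖(z t).1 - (z t).2‖ ^ 2 ∂γ = hellingerValue Φx Φy := by
  have hmx := hΦx.memLp_top hbx
  have hmy := hΦy.memLp_top hby
  obtain ⟨w, hw, hw2, hwgauss, hwmean, hwstat, hxx, hxy⟩ :=
    exists_optimal_process hpy hzy hΦx hΦy hbx hby
  have hwm : Measurable fun (z : (Fin d → ℤ) → EuclideanSpace ℝ (Fin m)) t => w t z :=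
    measurable_pi_lambda _ hw
  have hshift : ∀ r : Fin d → ℤ, Measurable fun (z : (Fin d → ℤ) → EuclideanSpace ℝ (Fin m) ×
      EuclideanSpace ℝ (Fin m)) t => z (t + r) := fun r =>
    measurable_pi_lambda _ fun t => measurable_pi_apply _
  have hfst : Measurable fun (z : (Fin d → ℤ) → EuclideanSpace ℝ (Fin m) ×
      EuclideanSpace ℝ (Fin m)) t => (z t).1 :=
    measurable_pi_lambda _ fun t => measurable_fst.comp (measurable_pi_apply t)
  have hsnd : Measurable fun (z : (Fin d → ℤ) → EuclideanSpace ℝ (Fin m) ×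
      EuclideanSpace ℝ (Fin m)) t => (z t).2 :=
    measurable_pi_lambda _ fun t => measurable_snd.comp (measurable_pi_apply t)
  refine ⟨py.map fun z t => w t z, ⟨hwgauss.map_coord hw, fun r => ?_, ?_, ?_⟩, fun t => ?_⟩
  · rw [Measure.map_map (hshift r) hwm]
    exact IsGaussianProcess.map_ext (hwgauss.comp_right fun t => t + r) hwgauss
      (fun t => hw (t + r)) hw sum_pairCoord_smul_pairVec
      (fun t q => (hwmean q (t + r)).trans (hwmean q t).symm)
      fun s t q q' => hwstat q q' t s r
  · rw [Measure.map_map hfst hwm]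
    have h := IsGaussianProcess.map_ext
      (hwgauss.comp_left fun _ => ContinuousLinearMap.fst ℝ _ _) hpx
      (fun t => measurable_fst.comp (hw t)) (fun t => measurable_pi_apply t)
      sum_coordCLM_smul_single
      (fun t i => (hwmean (Sum.inl i) t).trans (hzx.integral_coord hpx t i).symm)
      fun s t i j => hxx i j t s
    exact h.trans Measure.map_id
  · rw [Measure.map_map hsnd hwm]
    have h : ((fun (z : (Fin d → ℤ) → EuclideanSpace ℝ (Fin m) × EuclideanSpace ℝ (Fin m)) t =>
        (z t).2) ∘ fun z t => w t z) = id := by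
      ext1 z
      exact funext fun t => hw2 t z
    rw [h, Measure.map_id]
  · have hm : Measurable fun z : (Fin d → ℤ) → EuclideanSpace ℝ (Fin m) ×
        EuclideanSpace ℝ (Fin m) => ‖(z t).1 - (z t).2‖ ^ 2 := by fun_prop
    rw [integral_map hwm.aemeasurable hm.aestronglyMeasurable]
    have hl : ∀ q t, MemLp (fun z => pairCoord m q (w t z)) 2 py := fun q t =>
      ((hwgauss.hasGaussianLaw_eval t).map_fun (pairCoord m q)).memLp_two
    rw [integral_norm_sub_sq (x := fun z => (w t z).1) (y := fun z => (w t z).2)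
      (fun i => hl (Sum.inl i) t) (fun i => hl (Sum.inr i) t)]
    have h1 : (∫ θ, (Matrix.fidelity (Φx θ) (Φy θ)).trace ∂(torusMeasure d)) =
        ((∑ i, ∫ z, (w t z).1 i * (w t z).2 i ∂py : ℝ) : ℂ) := by
      rw [Complex.ofReal_sum]
      simp only [hxy]
      have hintegrable : ∀ i, Integrable (fun θ =>
          (Matrix.transportMap (Φx θ) (Φy θ) * Φy θ) i i) (torusMeasure d) := fun i =>
        (memLp_top_of_continuousOn_posDefPairs (fun i j => (hmx i j).1)
          (fun i j => (hmy i j).1) hbx hby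
          (Matrix.continuousOn_transportMap.mul continuousOn_snd) i i).integrable le_top
      rw [← integral_finsetSum _ fun i _ => hintegrable i]
      refine integral_congr_ae ?_
      filter_upwards [hby.posDef] with θ hθ
      rw [← Matrix.trace_transportMap_mul hθ]
      rfl
    rw [hellingerValue_eq hmx hmy hbx hby, h1, Complex.ofReal_re]
    simp only [hxx, hw2]
    rw [hΦx.sum_variance, hΦy.sum_variance]

end Couplings

/-! ### Optimality over spectral factors -/

section SpectralFactors

variable {d m : ℕ} {Φx Φy W V : (Fin d → ℝ) → Matrix (Fin m) (Fin m) ℂ}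

theorem Matrix.sum_norm_sq_sub_eq (V W : Matrix (Fin m) (Fin m) ℂ) :
    ∑ i, ∑ j, ‖(V - W) i j‖ ^ 2 = (V * V.conjTranspose).trace.re +
      (W * W.conjTranspose).trace.re - 2 * (V * W.conjTranspose).trace.re := by
  have h := congrArg Complex.re (Matrix.trace_mul_conjTranspose_eq_sum (V - W))
  rw [Complex.ofReal_re] at h
  have h' : (W * V.conjTranspose).trace.re = (V * W.conjTranspose).trace.re := by
    have h0 : W * V.conjTranspose = (V * W.conjTranspose).conjTranspose := by
      rw [Matrix.conjTranspose_mul, Matrix.conjTranspose_conjTranspose]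
    rw [h0, Matrix.trace_conjTranspose]
    exact Complex.conj_re _
  rw [← h, Matrix.conjTranspose_sub, Matrix.sub_mul, Matrix.mul_sub, Matrix.mul_sub]
  simp only [Matrix.trace_sub, Complex.sub_re, h']
  ring

/-- Each `‖W i j‖²` is at most `tr (W W*) = tr Φ`. This makes every factor cost a genuine integral,
not the default value `0`, so integrating the pointwise bound is legitimate. -/
theorem IsSpectralFactor.memLp_two {Φ : (Fin d → ℝ) → Matrix (Fin m) (Fin m) ℂ}
    (h : IsSpectralFactor Φ W) (hΦ : ∀ i j, MemLp (fun θ => Φ θ i j) ⊤ (torusMeasure d))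
    (i j : Fin m) : MemLp (fun θ => W θ i j) 2 (torusMeasure d) := by
  refine (memLp_two_iff_integrable_sq_norm (h.1 i j)).2 ?_
  refine (integrable_trace hΦ).re.mono' ((h.1 i j).norm.pow 2) ?_
  filter_upwards [h.2] with θ hθ
  change ‖‖W θ i j‖ ^ 2‖ ≤ (Φ θ).trace.re
  rw [← hθ, Matrix.trace_mul_conjTranspose_eq_sum, Complex.ofReal_re, norm_pow, norm_norm]
  refine (Finset.single_le_sum (f := fun j => ‖W θ i j‖ ^ 2) (fun j _ => by positivity)
    (Finset.mem_univ j)).trans ?_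
  exact Finset.single_le_sum (f := fun i => ∑ j, ‖W θ i j‖ ^ 2) (fun i _ => by positivity)
    (Finset.mem_univ i)

variable (hmx : ∀ i j, MemLp (fun θ => Φx θ i j) ⊤ (torusMeasure d))
  (hmy : ∀ i j, MemLp (fun θ => Φy θ i j) ⊤ (torusMeasure d))
  (hbx : IsBoundedCoercive Φx) (hby : IsBoundedCoercive Φy)
include hmx hmy hbx hby

theorem hellingerValue_le_factorCost (hV : IsSpectralFactor Φx V) (hW : IsSpectralFactor Φy W) :
    hellingerValue Φx Φy ≤
      ∫ θ, ∑ i, ∑ j, ‖(V θ - W θ) i j‖ ^ 2 ∂(torusMeasure d) := by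
  refine integral_mono_ae (integrable_trace (memLp_top_hellingerIntegrand hmx hmy hbx hby)).re
    (integrable_finsetSum _ fun i _ => integrable_finsetSum _ fun j _ =>
      ((hV.memLp_two hmx i j).sub (hW.memLp_two hmy i j)).integrable_norm_pow two_ne_zero) ?_
  filter_upwards [hV.2, hW.2, hbx.posDef, hby.posDef] with θ hVθ hWθ hx hy
  change (hellingerIntegrand Φx Φy θ).trace.re ≤ _
  rw [re_trace_hellingerIntegrand, Matrix.sum_norm_sq_sub_eq, hVθ, hWθ]
  have h := Matrix.re_trace_mul_conjTranspose_le (hVθ.symm ▸ hx) (hWθ.symm ▸ hy)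
  rw [hVθ, hWθ] at h
  linarith

theorem hellingerValue_mem_factorCosts : hellingerValue Φx Φy ∈ factorCosts Φx Φy := by
  have hs : ContinuousOn (fun p : Matrix (Fin m) (Fin m) ℂ × Matrix (Fin m) (Fin m) ℂ =>
      CFC.sqrt p.2) (Matrix.posDefPairs (Fin m)) :=
    Matrix.continuousOn_cfcSqrt.comp continuousOn_snd fun p hp => hp.2.posSemidef.nonneg
  have hm : ∀ {F : Matrix (Fin m) (Fin m) ℂ × Matrix (Fin m) (Fin m) ℂ →
      Matrix (Fin m) (Fin m) ℂ}, ContinuousOn F (Matrix.posDefPairs (Fin m)) → ∀ i j,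
      AEStronglyMeasurable (fun θ => F (Φx θ, Φy θ) i j) (torusMeasure d) := fun hF i j =>
    (memLp_top_of_continuousOn_posDefPairs (fun i j => (hmx i j).1) (fun i j => (hmy i j).1)
      hbx hby hF i j).1
  have hae : ∀ᵐ θ ∂(torusMeasure d),
      CFC.sqrt (Φy θ) * (CFC.sqrt (Φy θ)).conjTranspose = Φy θ ∧
      (Matrix.transportMap (Φx θ) (Φy θ) * CFC.sqrt (Φy θ)) *
        (Matrix.transportMap (Φx θ) (Φy θ) * CFC.sqrt (Φy θ)).conjTranspose = Φx θ ∧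
      ((Matrix.transportMap (Φx θ) (Φy θ) * CFC.sqrt (Φy θ)) *
        (CFC.sqrt (Φy θ)).conjTranspose).trace =
          (Matrix.fidelity (Φx θ) (Φy θ)).trace := by
    filter_upwards [hbx.posDef, hby.posDef] with θ hx hy
    have h1 : CFC.sqrt (Φy θ) * (CFC.sqrt (Φy θ)).conjTranspose = Φy θ := by
      rw [hy.cfcSqrt.isHermitian.eq]
      exact CFC.sqrt_mul_sqrt_self _ hy.posSemidef.nonneg
    refine ⟨h1, ?_, ?_⟩
    · rw [Matrix.conjTranspose_mul, (hx.transportMap hy).isHermitian.eq, Matrix.mul_assoc,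
        ← Matrix.mul_assoc (CFC.sqrt (Φy θ)), h1, ← Matrix.mul_assoc,
        Matrix.transportMap_mul_mul_transportMap hx hy]
    · rw [Matrix.mul_assoc, h1, Matrix.trace_transportMap_mul hy]
  -- With `W = Φy^{1/2}` and `V = K W`, `V V* = K Φy K = Φx` and `V W* = K Φy`, whose trace is `tr
  -- F`.
  refine ⟨fun θ => Matrix.transportMap (Φx θ) (Φy θ) * CFC.sqrt (Φy θ),
    fun θ => CFC.sqrt (Φy θ), ⟨hm (Matrix.continuousOn_transportMap.mul hs), ?_⟩, ⟨hm hs, ?_⟩, ?_⟩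
  · filter_upwards [hae] with θ hθ using hθ.2.1
  · filter_upwards [hae] with θ hθ using hθ.1
  · refine integral_congr_ae ?_
    filter_upwards [hae] with θ hθ
    rw [re_trace_hellingerIntegrand, Matrix.sum_norm_sq_sub_eq, hθ.1, hθ.2.1, hθ.2.2]

theorem isLeast_factorCosts : IsLeast (factorCosts Φx Φy) (hellingerValue Φx Φy) := by
  refine ⟨hellingerValue_mem_factorCosts hmx hmy hbx hby, ?_⟩
  rintro c ⟨V, W, hV, hW, rfl⟩
  exact hellingerValue_le_factorCost hmx hmy hbx hby hV hW

end SpectralFactors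

/-! ### Equality of the transport and Hellinger distances -/

theorem proposition1 (d m : ℕ)
    (px py : Measure ((Fin d → ℤ) → EuclideanSpace ℝ (Fin m)))
    (hpx : IsGaussianField px) (hpy : IsGaussianField py)
    (hsx : IsStationaryField px) (hsy : IsStationaryField py)
    (hzx : IsZeroMeanField px) (hzy : IsZeroMeanField py)
    (Φx Φy : (Fin d → ℝ) → Matrix (Fin m) (Fin m) ℂ)
    (hΦx : IsSpectralDensity px Φx) (hΦy : IsSpectralDensity py Φy)
    (hbx : IsBoundedCoercive Φx) (hby : IsBoundedCoercive Φy) :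
    (∀ t : Fin d → ℤ, IsGLB (transportCosts px py t) (transportDist px py ^ 2)) ∧
    (∀ i j, Integrable (fun θ => hellingerIntegrand Φx Φy θ i j) (torusMeasure d)) ∧
    ((transportDist px py ^ 2 : ℝ) : ℂ) =
      (matrixTorusIntegral (hellingerIntegrand Φx Φy)).trace ∧
    IsGLB (factorCosts Φx Φy) (hellingerDist Φx Φy ^ 2) ∧
    transportDist px py = hellingerDist Φx Φy := by
  have hmx := hΦx.memLp_top hbx
  have hmy := hΦy.memLp_top hby
  obtain ⟨γ, hγ, hcost⟩ := exists_optimal_coupling hpx hpy hzx hzy hΦx hΦy hbx hby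
  -- The minimum is attained with the same value at every site, so the cost sets are nonempty and
  -- `sInf` is a true infimum.
  have htransport : ∀ t, IsLeast (transportCosts px py t) (hellingerValue Φx Φy) := by
    refine fun t => ⟨⟨γ, hγ, (hcost t).symm⟩, ?_⟩
    rintro c ⟨γ', hγ', rfl⟩
    exact hellingerValue_le_transportCost hΦx hΦy hbx hby hγ' t
  have hfactor := isLeast_factorCosts hmx hmy hbx hby
  have hnonneg : 0 ≤ hellingerValue Φx Φy := by
    rw [← hcost 0]
    exact integral_nonneg fun z => by positivity
  have h1 : transportDist px py = Real.sqrt (hellingerValue Φx Φy) := by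
    rw [transportDist, (htransport 0).csInf_eq]
  have h2 : hellingerDist Φx Φy = Real.sqrt (hellingerValue Φx Φy) := by
    rw [hellingerDist, hfactor.csInf_eq]
  rw [h1, h2, Real.sq_sqrt hnonneg]
  exact ⟨fun t => (htransport t).isGLB,
    fun i j => (memLp_top_hellingerIntegrand hmx hmy hbx hby i j).integrable le_top,
    ofReal_hellingerValue hmx hmy hbx hby, hfactor.isGLB, rfl⟩
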